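/- Let $N$ be the number of sites, $M\in\tfrac12\mathbb N$, and $\beta,\beta'\in\mathbb R$. Write $x_{ij}^\pm=x_i\pm x_j$, and let $\Omega\subset\mathbb R^N$ be the set of points with $x_i\neq 0$ for all $i$ and $x_i\neq\pm x_j$ for all $i\neq j$. All indices run from $1$ to $N$. Let $\mathcal S$ be the complex vector space with basis the kets $|s_1,\dots,s_N\rangle$, $s_i\in\{-M,-M+1,\dots,M\}$. Let $S_{ij}$ be the operator on $\mathcal S$ that exchanges $s_i$ and $s_j$, let $S_i$ be the operator that replaces $s_i$ by $-s_i$, and put $\tilde S_{ij}=S_iS_jS_{ij}$. Likewise, on functions of $\mathbf x=(x_1,\dots,x_N)\in\Omega$, let $K_{ij}$ exchange $x_i$ and $x_j$, let $K_i$ replace $x_i$ by $-x_i$, and put $\tilde K_{ij}=K_iK_jK_{ij}$. An operator that is a finite sum of terms $f(\mathbf x)K_{\alpha_1}\cdots K_{\alpha_r}$ (each $\alpha_k$ standing for a pair $ij$, $i\ne j$, or for an index $i$) has an image under the linear star mapping $$\big(f(\mathbf x)\,K_{\alpha_1}\cdots K_{\alpha_r}\big)^*=(-1)^r f(\mathbf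 x)\,S_{\alpha_r}\cdots S_{\alpha_1},$$ which is a function of $\mathbf x$ with values in the operators on $\mathcal S$. Define $$\mathcal J_i=\sum_{j\ne i}\Big[(1+\coth x_{ij}^-)K_{ij}+(1+\coth x_{ij}^+)\tilde K_{ij}\Big]+\big[\beta(1+\coth x_i)+\beta'(1+\tanh x_i)\big]K_i-2\sum_{j<i}K_{ij},\qquad \mathcal I_p=\sum_i\mathcal J_i^{2p},$$ $$\mathcal H^*(\mathbf x)=\sum_{i\ne j}\Big[\sinh^{-2}x_{ij}^-\,S_{ij}+\sinh^{-2}x_{ij}^+\,\tilde S_{ij}\Big]+\sum_i\big(\beta\sinh^{-2}x_i-\beta'\cosh^{-2}x_i\big)S_i,$$ $$U(\mathbf x)=\sum_{i\ne j}\big(\sinh^{-2}x_{ij}^-+\sinh^{-2}x_{ij}^+\big)+\sum_i\big(\beta^2\sinh^{-2}x_i-\beta'^2\cosh^{-2}x_i\big).$$ **Proposition.** Let $\mathbf x^0\in\Omega$ be an equilibrium point of $U$, that is, $\frac{\partial U}{\partial x_i}(\mathbf x^0)=0$ for $i=1,\dots,N$. Then for every $p\in\mathbb N$ the frozen operator $\mathcal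 I_p^{*0}=(\mathcal I_p)^*(\mathbf x^0)$ on $\mathcal S$ commutes with the spin chain Hamiltonian $\mathcal H^{*0}=\mathcal H^*(\mathbf x^0)$: $$\big[\mathcal H^{*0},\mathcal I_p^{*0}\big]=0 .$$ -/

import Mathlib

open scoped BigOperators

noncomputable section

namespace SutherlandBN

/-! ### The Weyl group of type `B_N` and its actions -/

/-- The hyperoctahedral group `{±1}^N ⋊ S_N`. -/
abbrev WeylGroup (N : ℕ) : Type :=
  (Fin N → ℤˣ) ⋊[mulAutArrow] Equiv.Perm (Fin N)

/-- The group element underlying `K_{ij}`, `S_{ij}`: exchange of `i` and `j`. -/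
def exch {N : ℕ} (i j : Fin N) : WeylGroup N := ⟨1, Equiv.swap i j⟩

/-- The group element underlying `K_i`, `S_i`: sign reversal of the `i`-th entry. -/
def flip {N : ℕ} (i : Fin N) : WeylGroup N := ⟨Function.update 1 i (-1), 1⟩

/-- The group element underlying `K_i K_j K_{ij}` and `S_i S_j S_{ij}`. -/
def exchTilde {N : ℕ} (i j : Fin N) : WeylGroup N := flip i * flip j * exch i j

theorem exch_inv {N : ℕ} (i j : Fin N) : (exch i j)⁻¹ = exch i j := by
  rw [inv_eq_iff_mul_eq_one]
  refine SemidirectProduct.ext ?_ ?_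
  · funext k
    simp [exch]
  · simp [exch]

theorem flip_inv {N : ℕ} (i : Fin N) : (flip i)⁻¹ = flip i := by
  rw [inv_eq_iff_mul_eq_one]
  refine SemidirectProduct.ext ?_ ?_
  · funext k
    by_cases h : k = i
    · subst h
      simp [flip]
    · simp [flip, h]
  · simp [flip]

theorem exchTilde_inv {N : ℕ} {i j : Fin N} (h : j ≠ i) :
    (exchTilde i j)⁻¹ = exchTilde i j := by
  rw [inv_eq_iff_mul_eq_one]
  have hl : ∀ k, (exchTilde i j).left k = if k = i ∨ k = j then -1 else 1 := by
    intro k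
    by_cases h1 : k = i
    · subst h1
      simp [exchTilde, exch, flip, h.symm]
    · by_cases h2 : k = j
      · subst h2
        simp [exchTilde, exch, flip, h]
      · simp [exchTilde, exch, flip, h1, h2]
  have hr : (exchTilde i j).right = Equiv.swap i j := by
    simp [exchTilde, exch, flip]
  refine SemidirectProduct.ext ?_ ?_
  · funext k
    change (exchTilde i j).left k * (exchTilde i j).left ((exchTilde i j).right⁻¹ k) = 1
    rw [hr, hl, hl, Equiv.swap_inv]
    by_cases h1 : k = i
    · subst h1
      simp
    · by_cases h2 : k = j
      · subst h2
        simp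
      · simp [h1, h2, Equiv.swap_apply_of_ne_of_ne h1 h2]
  · rw [SemidirectProduct.mul_right, hr]
    simp

/-- The signed permutation action on `N`-tuples with entries in a type with a negation:
`(w • s)_i = ε_i s_{σ⁻¹ i}` for `w = (ε, σ)`. -/
def act {N : ℕ} {α : Type*} [InvolutiveNeg α] (w : WeylGroup N) (s : Fin N → α) : Fin N → α :=
  fun i => if w.left i = 1 then s (w.right⁻¹ i) else -s (w.right⁻¹ i)

theorem act_one {N : ℕ} {α : Type*} [InvolutiveNeg α] (s : Fin N → α) :
    act (1 : WeylGroup N) s = s := by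
  funext i
  simp [act]

theorem act_mul {N : ℕ} {α : Type*} [InvolutiveNeg α] (v w : WeylGroup N) (s : Fin N → α) :
    act (v * w) s = act v (act w s) := by
  funext i
  have h : (v * w).left i = v.left i * w.left (v.right⁻¹ i) := rfl
  have h' : (v * w).right⁻¹ i = w.right⁻¹ (v.right⁻¹ i) := by
    simp [mul_inv_rev]
  simp only [act, h, h']
  rcases Int.units_eq_one_or (v.left i) with h1 | h1 <;>
    rcases Int.units_eq_one_or (w.left (v.right⁻¹ i)) with h2 | h2 <;>
    rw [h1, h2] <;> simp

theorem act_exch {N : ℕ} {α : Type*} [InvolutiveNeg α] (i j : Fin N) (s : Fin N → α) :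
    act (exch i j) s = fun k => s (Equiv.swap i j k) := by
  funext k
  simp [act, exch]

theorem act_flip {N : ℕ} {α : Type*} [InvolutiveNeg α] (i : Fin N) (s : Fin N → α) :
    act (flip i) s = Function.update s i (-s i) := by
  funext k
  by_cases h : k = i
  · subst h
    simp [act, flip]
  · simp [act, flip, h]

/-- The character of the Weyl group with value `-1` on every exchange and on every sign
reversal. -/
def parity {N : ℕ} : WeylGroup N →* ℤˣ where
  toFun w := (∏ i, w.left i) * Equiv.Perm.sign w.right
  map_one' := by simp
  map_mul' v w := by
    have h : ∀ i, (v * w).left i = v.left i * w.left (v.right⁻¹ i) := fun _ => rfl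
    have h' : (∏ i, w.left (v.right⁻¹ i)) = ∏ i, w.left i :=
      Equiv.prod_comp (v.right⁻¹) w.left
    simp only [h, Finset.prod_mul_distrib, h', SemidirectProduct.mul_right, map_mul]
    exact mul_mul_mul_comm _ _ _ _

theorem parity_exch {N : ℕ} {i j : Fin N} (h : i ≠ j) : parity (exch i j) = -1 := by
  simp [parity, exch, Equiv.Perm.sign_swap h]

theorem parity_flip {N : ℕ} (i : Fin N) : parity (flip i) = -1 := by
  simp [parity, flip, Finset.prod_update_of_mem]

/-! ### Configurations, coefficient functions, and operators `∑_w f_w(x) w` -/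

/-- Points of `ℝ^N` off the hyperplanes `x_i = 0`, `x_i = x_j`, `x_i = -x_j`, where all the
coefficient functions below are regular. -/
def RegularPoint (N : ℕ) : Type :=
  {x : Fin N → ℝ // (∀ i, x i ≠ 0) ∧ ∀ i j, i ≠ j → x i ≠ x j ∧ x i ≠ -x j}

theorem regular_act {N : ℕ} (w : WeylGroup N) (x : RegularPoint N) :
    (∀ i, act w x.1 i ≠ 0) ∧
      ∀ i j, i ≠ j → act w x.1 i ≠ act w x.1 j ∧ act w x.1 i ≠ -act w x.1 j := by
  refine ⟨fun i => ?_, fun i j hij => ?_⟩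
  · have := x.2.1 (w.right⁻¹ i)
    unfold act
    split_ifs <;> simpa using this
  · have hne : w.right⁻¹ i ≠ w.right⁻¹ j := fun h => hij (w.right⁻¹.injective h)
    obtain ⟨h1, h2⟩ := x.2.2 _ _ hne
    have h3 : -x.1 (w.right⁻¹ i) ≠ x.1 (w.right⁻¹ j) := fun h => h2 (by rw [← h, neg_neg])
    unfold act
    split_ifs <;> simp only [ne_eq, neg_inj, neg_neg] <;> exact ⟨by assumption, by assumption⟩

instance (N : ℕ) : MulAction (WeylGroup N) (RegularPoint N) where
  smul w x := ⟨act w x.1, regular_act w x⟩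
  one_smul x := Subtype.ext (act_one x.1)
  mul_smul v w x := Subtype.ext (act_mul v w x.1)

theorem coe_smul {N : ℕ} (w : WeylGroup N) (x : RegularPoint N) : (w • x).1 = act w x.1 := rfl

/-- The algebra of coefficient functions. -/
abbrev CoeffFun (N : ℕ) : Type := RegularPoint N → ℝ

/-- The Weyl group acts on functions by `(w f)(x) = f(w⁻¹ x)`; for exchanges and sign reversals
this is the action of `K_{ij}` and `K_i` on functions. -/
instance (N : ℕ) : MulSemiringAction (WeylGroup N) (CoeffFun N) where
  smul w f := fun x => f (w⁻¹ • x)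
  one_smul f := funext fun x => by
    change f ((1 : WeylGroup N)⁻¹ • x) = f x
    rw [inv_one, one_smul]
  mul_smul v w f := funext fun x => by
    change f ((v * w)⁻¹ • x) = f (w⁻¹ • v⁻¹ • x)
    rw [mul_inv_rev, mul_smul]
  smul_zero _ := rfl
  smul_add _ _ _ := rfl
  smul_one _ := rfl
  smul_mul _ _ _ := rfl

theorem weyl_smul_apply {N : ℕ} (w : WeylGroup N) (f : CoeffFun N) (x : RegularPoint N) :
    (w • f) x = f (w⁻¹ • x) := rfl

/-- The algebra of operators `∑_w f_w(x) w` (functions tensor the algebra generated by the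
`K_{ij}` and `K_i`), multiplied by composition: `(f v)(g w) = f (v g) (v w)`. The element
`f(x) w` is `SkewMonoidAlgebra.single w f`. -/
abbrev OpAlgebra (N : ℕ) : Type := SkewMonoidAlgebra (CoeffFun N) (WeylGroup N)

/-- The operator on functions given by an element of `OpAlgebra N`: `f(x) w` sends `g` to the
function `x ↦ f(x) g(w⁻¹ x)`. -/
def toOperator (N : ℕ) : OpAlgebra N →+* Module.End ℝ (CoeffFun N) :=
  SkewMonoidAlgebra.liftNCRingHom
    (Algebra.lmul ℝ (CoeffFun N)).toRingHom
    ({ toFun := fun w =>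
        { toFun := fun g => w • g
          map_add' := fun _ _ => rfl
          map_smul' := fun _ _ => rfl }
       map_one' := LinearMap.ext fun g => one_smul _ g
       map_mul' := fun v w => LinearMap.ext fun g => mul_smul v w g } :
      WeylGroup N →* Module.End ℝ (CoeffFun N))
    (fun {f w} => LinearMap.ext fun g => (smul_mul' w f g).symm)

theorem toOperator_single {N : ℕ} (w : WeylGroup N) (f g : CoeffFun N) (x : RegularPoint N) :
    toOperator N (SkewMonoidAlgebra.single w f) g x = f x * g (w⁻¹ • x) := by
  have h : toOperator N (SkewMonoidAlgebra.single w f) = _ :=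
    SkewMonoidAlgebra.liftNC_single _ _ _ _
  rw [h]
  rfl

theorem regular_free {N : ℕ} {w : WeylGroup N} {x : RegularPoint N} (h : w • x = x) : w = 1 := by
  have hx : ∀ i, act w x.1 i = x.1 i := fun i => congrFun (congrArg Subtype.val h) i
  have hr : ∀ i, w.right⁻¹ i = i := by
    intro i
    by_contra hne
    obtain ⟨h1, h2⟩ := x.2.2 _ _ hne
    have h3 := hx i
    unfold act at h3
    split_ifs at h3
    · exact h1 h3
    · exact h2 (by rw [← h3, neg_neg])
  have hl : ∀ i, w.left i = 1 := by
    intro i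
    by_contra hne
    have h3 := hx i
    unfold act at h3
    rw [if_neg hne, hr i] at h3
    exact x.2.1 i (by linarith)
  refine SemidirectProduct.ext (funext hl) ?_
  exact inv_eq_one.1 (Equiv.ext hr)

/-- An element of `OpAlgebra N` is determined by the operator that it defines. -/
theorem toOperator_injective (N : ℕ) : Function.Injective (toOperator N) := by
  classical
  rw [injective_iff_map_eq_zero]
  intro A hA
  refine SkewMonoidAlgebra.ext fun w => funext fun x => ?_
  have key : ∀ B : OpAlgebra N,
      toOperator N B (fun y => if y = w⁻¹ • x then 1 else 0) x = B.coeff w x := by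
    intro B
    induction B using SkewMonoidAlgebra.induction_on with
    | zero => simp
    | single v f =>
      rw [toOperator_single, SkewMonoidAlgebra.coeff_single_apply]
      by_cases hv : v = w
      · subst hv
        simp
      · have hne : v⁻¹ • x ≠ w⁻¹ • x := by
          intro h
          have h1 : (w * v⁻¹) • x = x := by rw [mul_smul, h, smul_inv_smul]
          exact hv (mul_inv_eq_one.1 (regular_free h1)).symm
        simp [hne, hv]
    | add f g hf hg =>
      rw [map_add, LinearMap.add_apply, Pi.add_apply, hf, hg, SkewMonoidAlgebra.coeff_add]
      rfl
  rw [← key A, hA]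
  rfl

/-! ### Spins -/

/-- The spin values `-M, -M+1, …, M` with `M = n/2`. -/
def Spin (n : ℕ) : Type := {s : ℚ // ∃ k : ℕ, k ≤ n ∧ s = k - (n : ℚ) / 2}

instance (n : ℕ) : InvolutiveNeg (Spin n) where
  neg s := ⟨-s.1, by
    obtain ⟨k, hk, hs⟩ := s.2
    refine ⟨n - k, Nat.sub_le _ _, ?_⟩
    rw [hs, Nat.cast_sub hk]
    ring⟩
  neg_neg s := Subtype.ext (neg_neg s.1)

/-- The spin space of `N` particles of spin `M = n/2`, with basis the kets `|s_1, …, s_N⟩`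
(`|s⟩` is `Finsupp.single s 1`). -/
abbrev SpinSpace (N n : ℕ) : Type := (Fin N → Spin n) →₀ ℂ

/-- The operator of `w` on spin space, `|s⟩ ↦ |w • s⟩`. -/
def spinRep {N : ℕ} (n : ℕ) : WeylGroup N →* Module.End ℂ (SpinSpace N n) where
  toFun w := Finsupp.lmapDomain ℂ ℂ (act w)
  map_one' := by
    have h : (act (1 : WeylGroup N) : (Fin N → Spin n) → (Fin N → Spin n)) = id :=
      funext act_one
    rw [h, Finsupp.lmapDomain_id]
    rfl
  map_mul' v w := by
    have h : (act (v * w) : (Fin N → Spin n) → (Fin N → Spin n)) = act v ∘ act w :=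
      funext (act_mul v w)
    rw [h, Finsupp.lmapDomain_comp]
    rfl

/-- The exchange operator `S_{ij}`. -/
def spinExch {N : ℕ} (n : ℕ) (i j : Fin N) : Module.End ℂ (SpinSpace N n) := spinRep n (exch i j)

/-- The spin reversal operator `S_i`. -/
def spinFlip {N : ℕ} (n : ℕ) (i : Fin N) : Module.End ℂ (SpinSpace N n) := spinRep n (flip i)

theorem spinExch_ket {N n : ℕ} (i j : Fin N) (s : Fin N → Spin n) :
    spinExch n i j (Finsupp.single s 1) =
      Finsupp.single (fun k => s (Equiv.swap i j k)) (1 : ℂ) := by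
  simp [spinExch, spinRep, act_exch]

theorem spinFlip_ket {N n : ℕ} (i : Fin N) (s : Fin N → Spin n) :
    spinFlip n i (Finsupp.single s 1) =
      Finsupp.single (Function.update s i (-s i)) (1 : ℂ) := by
  simp [spinFlip, spinRep, act_flip]

/-- The operator `S_i S_j S_{ij}`. -/
def spinExchTilde {N : ℕ} (n : ℕ) (i j : Fin N) : Module.End ℂ (SpinSpace N n) :=
  spinFlip n i * spinFlip n j * spinExch n i j

/-- The star mapping, the linear map with
`(f(x) K_{α_1} ⋯ K_{α_r})^* = (-1)^r f(x) S_{α_r} ⋯ S_{α_1}`, that is, `f(x) w` is sent to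
`parity(w) f(x) S(w⁻¹)` (see `star_word`). Its values are functions with values in the
operators on spin space. -/
def star {N : ℕ} (n : ℕ) (A : OpAlgebra N) : RegularPoint N → Module.End ℂ (SpinSpace N n) :=
  fun x => A.sum fun w f => (((parity w : ℤ) : ℝ) * f x) • spinRep n w⁻¹

theorem star_add {N : ℕ} (n : ℕ) (A B : OpAlgebra N) : star n (A + B) = star n A + star n B := by
  funext x
  refine SkewMonoidAlgebra.sum_add_index' (fun w => ?_) (fun w f g => ?_)
  · simp
  · simp [mul_add, add_smul]

theorem star_single {N : ℕ} (n : ℕ) (w : WeylGroup N) (f : CoeffFun N) (x : RegularPoint N) :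
    star n (SkewMonoidAlgebra.single w f) x =
      (((parity w : ℤ) : ℝ) * f x) • spinRep n w⁻¹ :=
  SkewMonoidAlgebra.sum_single_index (by simp)

theorem star_word {N : ℕ} (n : ℕ) (f : CoeffFun N) (x : RegularPoint N) (L : List (WeylGroup N))
    (hL : ∀ w ∈ L, (∃ i j, i ≠ j ∧ w = exch i j) ∨ ∃ i, w = flip i) :
    star n (SkewMonoidAlgebra.single L.prod f) x =
      ((-1) ^ L.length * f x) • (L.reverse.map (spinRep n)).prod := by
  have hinv : ∀ w ∈ L, w⁻¹ = w := by
    intro w hw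
    rcases hL w hw with ⟨i, j, -, rfl⟩ | ⟨i, rfl⟩
    · exact exch_inv i j
    · exact flip_inv i
  have hpar : parity L.prod = (-1) ^ L.length := by
    rw [map_list_prod]
    refine (List.prod_eq_pow_card _ (-1) ?_).trans (by rw [List.length_map])
    intro u hu
    obtain ⟨w, hw, rfl⟩ := List.mem_map.1 hu
    rcases hL w hw with ⟨i, j, h, rfl⟩ | ⟨i, rfl⟩
    · exact parity_exch h
    · exact parity_flip i
  have hrev : L.prod⁻¹ = L.reverse.prod := by
    rw [List.prod_inv_reverse, List.map_congr_left hinv, List.map_id']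
  rw [star_single, hpar, hrev, map_list_prod]
  simp

/-! ### The hyperbolic Sutherland spin chain of `B_N` type -/

/-- `sinh⁻² t`. -/
def csch2 (t : ℝ) : ℝ := 1 / Real.sinh t ^ 2

/-- `cosh⁻² t`. -/
def sech2 (t : ℝ) : ℝ := 1 / Real.cosh t ^ 2

/-- `coth t`. -/
def coth (t : ℝ) : ℝ := Real.cosh t / Real.sinh t

/-- The operator `𝒥_i`, defined by `J_i = ∂_{x_i} - a 𝒥_i` with `β = b/a`, `β' = b'/a`, where
`J_i` is the Dunkl operator (see `dunkl_eq`). -/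
def calJ {N : ℕ} (β β' : ℝ) (i : Fin N) : OpAlgebra N :=
  ∑ j with j ≠ i,
      (SkewMonoidAlgebra.single (exch i j) (fun x : RegularPoint N => 1 + coth (x.1 i - x.1 j)) +
        SkewMonoidAlgebra.single (exchTilde i j)
          (fun x : RegularPoint N => 1 + coth (x.1 i + x.1 j))) +
    SkewMonoidAlgebra.single (flip i)
      (fun x : RegularPoint N => β * (1 + coth (x.1 i)) + β' * (1 + Real.tanh (x.1 i))) -
    2 • ∑ j with j < i, SkewMonoidAlgebra.single (exch i j) (1 : CoeffFun N)

/-- The partial derivative `∂ψ/∂x_i` at `x`. -/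
def partialDeriv {N : ℕ} (i : Fin N) (ψ : (Fin N → ℝ) → ℝ) (x : Fin N → ℝ) : ℝ :=
  deriv (fun t => ψ (Function.update x i t)) (x i)

/-- The `B_N`-type Dunkl operator `J_i` with parameters `a`, `b`, `b'`. -/
def dunkl {N : ℕ} (a b b' : ℝ) (i : Fin N) (ψ : (Fin N → ℝ) → ℝ) (x : RegularPoint N) : ℝ :=
  partialDeriv i ψ x.1
    - a * ∑ j with j ≠ i,
        ((1 + coth (x.1 i - x.1 j)) * ψ (act (exch i j) x.1) +
          (1 + coth (x.1 i + x.1 j)) * ψ (act (exchTilde i j) x.1))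
    - (b * (1 + coth (x.1 i)) + b' * (1 + Real.tanh (x.1 i))) * ψ (act (flip i) x.1)
    + 2 * a * ∑ j with j < i, ψ (act (exch i j) x.1)

theorem dunkl_eq {N : ℕ} {a : ℝ} (ha : a ≠ 0) (b b' : ℝ) (i : Fin N) (ψ : (Fin N → ℝ) → ℝ)
    (x : RegularPoint N) :
    dunkl a b b' i ψ x =
      partialDeriv i ψ x.1 - a * toOperator N (calJ (b / a) (b' / a) i) (fun y => ψ y.1) x := by
  have h1 : toOperator N (calJ (b / a) (b' / a) i) (fun y => ψ y.1) x =
      ∑ j with j ≠ i,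
        ((1 + coth (x.1 i - x.1 j)) * ψ (act (exch i j) x.1) +
          (1 + coth (x.1 i + x.1 j)) * ψ (act (exchTilde i j) x.1)) +
      (b / a * (1 + coth (x.1 i)) + b' / a * (1 + Real.tanh (x.1 i))) * ψ (act (flip i) x.1) -
      2 * ∑ j with j < i, ψ (act (exch i j) x.1) := by
    unfold calJ
    simp only [map_add, map_sub, map_sum, two_nsmul, two_mul, LinearMap.add_apply, LinearMap.sub_apply,
      LinearMap.sum_apply, Pi.add_apply, Pi.sub_apply, Finset.sum_apply,
      toOperator_single, exch_inv, flip_inv, coe_smul, Pi.one_apply, one_mul]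
    congr 2
    refine Finset.sum_congr rfl fun j hj => ?_
    rw [exchTilde_inv (Finset.mem_filter.1 hj).2]
  rw [h1, dunkl]
  field_simp
  ring

/-- `ℐ_p = ∑_i 𝒥_i^{2p}`. -/
def calI {N : ℕ} (β β' : ℝ) (p : ℕ) : OpAlgebra N := ∑ i, calJ β β' i ^ (2 * p)

/-- The potential `U`. -/
def potential {N : ℕ} (β β' : ℝ) (x : Fin N → ℝ) : ℝ :=
  ∑ i, ∑ j with j ≠ i, (csch2 (x i - x j) + csch2 (x i + x j)) +
    ∑ i, (β ^ 2 * csch2 (x i) - β' ^ 2 * sech2 (x i))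

/-- `x` is an equilibrium point: all the partial derivatives of `U` vanish at `x`. -/
def IsEquilibrium {N : ℕ} (β β' : ℝ) (x : RegularPoint N) : Prop :=
  ∀ i, HasDerivAt (fun t => potential β β' (Function.update x.1 i t)) 0 (x.1 i)

/-- The operator `ℋ^*`, a function of `x` with values in the operators on spin space. -/
def calHStar {N : ℕ} (n : ℕ) (β β' : ℝ) (x : RegularPoint N) : Module.End ℂ (SpinSpace N n) :=
  ∑ i, ∑ j with j ≠ i,
      (csch2 (x.1 i - x.1 j) • spinExch n i j + csch2 (x.1 i + x.1 j) • spinExchTilde n i j) +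
    ∑ i, (β * csch2 (x.1 i) - β' * sech2 (x.1 i)) • spinFlip n i

/-- The operator `ℐ_p^*`, a function of `x` with values in the operators on spin space. -/
def calIStar {N : ℕ} (n : ℕ) (β β' : ℝ) (p : ℕ) (x : RegularPoint N) :
    Module.End ℂ (SpinSpace N n) :=
  star n (calI β β' p) x

end SutherlandBN

end

noncomputable section

namespace SutherlandBN

/-! ### The root system of type `B_N` -/

/-! Write C_α for `rootCoth`, K_α for `rootSign` and H_α for `rootCsch`, and let s_α be the
reflection in α. Then 𝒥_i = ∑_α ½ α_i (C_α + K_α) s_α over all roots (`calJ_eq`). Put H = ∑_α ½ H_α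
s_α; the star image of H is -ℋ^* (`calHStar_eq`).

The first ingredient is `hamiltonian_mul_calJ_sub`: [H, 𝒥_i] is multiplication by ∂U/∂x_i, with no
reflection left. As U is invariant under the Weyl group, its gradient vanishes on the whole orbit of
the equilibrium x₀. Operators whose coefficients vanish on that orbit form a two-sided ideal, so the
Leibniz rule puts every [H, 𝒥_i^{2p}], hence [H, ℐ_p], in this ideal
(`commutator_hamiltonian_calI`), and its star image is zero at x₀.

The second ingredient makes this descend to spin operators. The star mapping reverses the order of
group elements, but (AB)^* = A^* B^* whenever B commutes with the group elements occurring in A,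
since these can then be moved to the right of B before the order is reversed (`star_single_mul`). So
H and ℐ_p must both be Weyl invariant. For H this is clear (`commute_hamiltonian`). For ℐ_p it
follows as in a degenerate affine Hecke algebra: the 𝒥_i commute (`commute_calJ`), conjugation by a
simple reflection permutes them up to sign and an additive constant (`hecke_relation`), and such
relations force even power sums to commute with the simple reflections, which generate the group
(`commute_reflection_calI`).

Both commutators are sums over pairs of roots, with group element s_α s_β. The map `rotate` keeps
s_α s_β fixed, so it suffices that the coefficients cancel along its orbits (`sum_pairs_eq_zero`).
These lie in planes of type A₁×A₁, A₂ or B₂, and the last two need addition formulas for coth and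
tanh. -/

/-- The roots of type `B_N`: the integer vectors of squared length `1` or `2`. -/
def roots (N : ℕ) : Finset (Fin N → ℤ) :=
  (Fintype.piFinset fun _ => Finset.Icc (-1) 1).filter fun a => a ⬝ᵥ a = 1 ∨ a ⬝ᵥ a = 2

theorem sq_le_dotProduct_self {N : ℕ} (a : Fin N → ℤ) (i : Fin N) : a i * a i ≤ a ⬝ᵥ a :=
  Finset.single_le_sum (f := fun k => a k * a k) (fun k _ => mul_self_nonneg (a k))
    (Finset.mem_univ i)

theorem mem_roots {N : ℕ} {a : Fin N → ℤ} : a ∈ roots N ↔ a ⬝ᵥ a = 1 ∨ a ⬝ᵥ a = 2 := by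
  simp only [roots, Finset.mem_filter, Fintype.mem_piFinset, Finset.mem_Icc, and_iff_right_iff_imp]
  intro h i
  have := sq_le_dotProduct_self a i
  rcases h with h | h <;> constructor <;> nlinarith

/-- Squared length at most 2 forces the entries into {-1, 0, 1}; removing one nonzero entry ε e_i
lowers the squared length by 1. Iterating gives the explicit forms ε e_i and ε e_i + δ e_j of the
roots. -/
theorem exists_peel {N : ℕ} {a : Fin N → ℤ} (h0 : a ⬝ᵥ a ≠ 0) (h2 : a ⬝ᵥ a ≤ 2) :
    ∃ (i : Fin N) (ε : ℤˣ), a i = ε ∧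
      (a - Pi.single i (ε : ℤ)) ⬝ᵥ (a - Pi.single i (ε : ℤ)) = a ⬝ᵥ a - 1 := by
  obtain ⟨i, hi⟩ : ∃ i, a i ≠ 0 := by
    by_contra! h
    exact h0 (by simp [dotProduct, h])
  have h1 := sq_le_dotProduct_self a i
  have h3 : a i = 1 ∨ a i = -1 := by
    have : a i ≤ 1 := by nlinarith
    have : -1 ≤ a i := by nlinarith
    omega
  obtain ⟨ε, hε⟩ : ∃ ε : ℤˣ, a i = ε := by
    rcases h3 with h | h
    · exact ⟨1, by simp [h]⟩
    · exact ⟨-1, by simp [h]⟩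
  refine ⟨i, ε, hε, ?_⟩
  have hs : (ε : ℤ) * ε = 1 := by rcases Int.units_eq_one_or ε with rfl | rfl <;> rfl
  simp only [sub_dotProduct, dotProduct_sub, single_dotProduct, dotProduct_single, hε,
    Pi.sub_apply, Pi.single_eq_same]
  linarith

theorem exists_of_sq_eq_one {N : ℕ} {a : Fin N → ℤ} (h : a ⬝ᵥ a = 1) :
    ∃ (i : Fin N) (ε : ℤˣ), a = Pi.single i (ε : ℤ) := by
  obtain ⟨i, ε, -, h1⟩ := exists_peel (by omega) (by omega : a ⬝ᵥ a ≤ 2)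
  rw [h, sub_self, dotProduct_self_eq_zero, sub_eq_zero] at h1
  exact ⟨i, ε, h1⟩

theorem exists_of_sq_eq_two {N : ℕ} {a : Fin N → ℤ} (h : a ⬝ᵥ a = 2) :
    ∃ (i j : Fin N) (ε δ : ℤˣ), i ≠ j ∧ a = Pi.single i (ε : ℤ) + Pi.single j (δ : ℤ) := by
  obtain ⟨i, ε, hi, h1⟩ := exists_peel (by omega) (by omega : a ⬝ᵥ a ≤ 2)
  obtain ⟨j, δ, hj⟩ := exists_of_sq_eq_one (h1.trans (by rw [h]; norm_num))
  refine ⟨i, j, ε, δ, ?_, by rw [← hj]; abel⟩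
  rintro rfl
  have h2 := congrFun hj i
  simp [hi] at h2
  exact δ.ne_zero h2.symm

theorem neg_mem_roots {N : ℕ} {a : Fin N → ℤ} : -a ∈ roots N ↔ a ∈ roots N := by
  simp [mem_roots]

/-- The value `α · x` of a root at a point. -/
def pair {N : ℕ} (a : Fin N → ℤ) (x : Fin N → ℝ) : ℝ := ∑ k, (a k : ℝ) * x k

theorem pair_sub {N : ℕ} (a b : Fin N → ℤ) (x : Fin N → ℝ) :
    pair (a - b) x = pair a x - pair b x := by
  simp [pair, sub_mul]

theorem pair_neg {N : ℕ} (a : Fin N → ℤ) (x : Fin N → ℝ) : pair (-a) x = -pair a x := by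
  simp [pair]

theorem pair_add {N : ℕ} (a b : Fin N → ℤ) (x : Fin N → ℝ) :
    pair (a + b) x = pair a x + pair b x := by
  simp [pair, add_mul, Finset.sum_add_distrib]

theorem pair_smul {N : ℕ} (n : ℤ) (a : Fin N → ℤ) (x : Fin N → ℝ) :
    pair (n • a) x = n * pair a x := by
  simp [pair, Finset.mul_sum, mul_assoc]

theorem pair_single {N : ℕ} (i : Fin N) (n : ℤ) (x : Fin N → ℝ) :
    pair (Pi.single i n) x = n * x i := by
  rw [pair, Finset.sum_eq_single i] <;> simp +contextual

theorem pair_ne_zero {N : ℕ} {a : Fin N → ℤ} (ha : a ∈ roots N) (x : RegularPoint N) :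
    pair a x.1 ≠ 0 := by
  rcases mem_roots.1 ha with h | h
  · obtain ⟨i, ε, rfl⟩ := exists_of_sq_eq_one h
    rw [pair_single]
    exact mul_ne_zero (by exact_mod_cast ε.ne_zero) (x.2.1 i)
  · obtain ⟨i, j, ε, δ, hij, rfl⟩ := exists_of_sq_eq_two h
    obtain ⟨h1, h2⟩ := x.2.2 i j hij
    rw [pair_add, pair_single, pair_single]
    rcases Int.units_eq_one_or ε with rfl | rfl <;> rcases Int.units_eq_one_or δ with rfl | rfl <;>
      simp only [Units.val_one, Units.val_neg, Int.cast_one, Int.cast_neg] <;> intro h3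
    · exact h2 (by linarith)
    · exact h1 (by linarith)
    · exact h1 (by linarith)
    · exact h2 (by linarith)

/-! ### The Weyl group action on integer vectors -/

theorem act_sub {N : ℕ} (w : WeylGroup N) (a b : Fin N → ℤ) :
    act w (a - b) = act w a - act w b := by
  funext i
  simp only [act, Pi.sub_apply]
  split_ifs <;> ring

theorem act_neg {N : ℕ} (w : WeylGroup N) (a : Fin N → ℤ) : act w (-a) = -act w a := by
  funext i
  simp only [act, Pi.neg_apply]
  split_ifs <;> ring

theorem act_smul {N : ℕ} (w : WeylGroup N) (n : ℤ) (a : Fin N → ℤ) :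
    act w (n • a) = n • act w a := by
  funext i
  simp only [act, Pi.smul_apply, smul_eq_mul]
  split_ifs <;> ring

theorem act_dotProduct {N : ℕ} (w : WeylGroup N) (a b : Fin N → ℤ) :
    act w a ⬝ᵥ act w b = a ⬝ᵥ b := by
  rw [dotProduct, dotProduct, ← Equiv.sum_comp (w.right⁻¹) fun k => a k * b k]
  refine Finset.sum_congr rfl fun i _ => ?_
  simp only [act]
  split_ifs <;> ring

theorem pair_act {N : ℕ} (w : WeylGroup N) (a : Fin N → ℤ) (x : Fin N → ℝ) :
    pair (act w a) (act w x) = pair a x := by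
  rw [pair, pair, ← Equiv.sum_comp (w.right⁻¹) fun k => (a k : ℝ) * x k]
  refine Finset.sum_congr rfl fun i _ => ?_
  simp only [act]
  split_ifs <;> push_cast <;> ring

theorem pair_inv_smul {N : ℕ} (w : WeylGroup N) (a : Fin N → ℤ) (x : RegularPoint N) :
    pair a (w⁻¹ • x).1 = pair (act w a) x.1 := by
  rw [← pair_act w, ← coe_smul, smul_inv_smul]

theorem act_mem_roots {N : ℕ} (w : WeylGroup N) {a : Fin N → ℤ} :
    act w a ∈ roots N ↔ a ∈ roots N := by
  simp [mem_roots, act_dotProduct]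

theorem sum_roots_act {N : ℕ} {M : Type*} [AddCommMonoid M] (w : WeylGroup N)
    (F : (Fin N → ℤ) → M) : ∑ a ∈ roots N, F (act w a) = ∑ a ∈ roots N, F a := by
  refine Finset.sum_nbij' (act w) (act w⁻¹) (fun a ha => (act_mem_roots w).2 ha)
    (fun a ha => (act_mem_roots _).2 ha) ?_ ?_ (fun _ _ => rfl)
  · intro a _
    rw [← act_mul, inv_mul_cancel, act_one]
  · intro a _
    rw [← act_mul, mul_inv_cancel, act_one]

/-- The regular integer point `(N, N - 1, …, 1)`, which defines the positive roots. -/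
def rho (N : ℕ) : RegularPoint N :=
  ⟨fun i => (N : ℝ) - (i : ℕ), by
    have hpos : ∀ i : Fin N, (0 : ℝ) < (N : ℝ) - (i : ℕ) := fun i => by
      have : ((i : ℕ) : ℝ) < N := by exact_mod_cast i.2
      linarith
    refine ⟨fun i => (hpos i).ne', fun i j hij => ⟨fun h => hij ?_, fun h => ?_⟩⟩
    · refine Fin.ext ?_
      have h2 : ((i : ℕ) : ℝ) = ((j : ℕ) : ℝ) := by linarith
      exact_mod_cast h2
    · have h1 := hpos i
      have h2 := hpos j
      have h3 : (N : ℝ) - (i : ℕ) = -((N : ℝ) - (j : ℕ)) := h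
      linarith⟩

theorem rho_apply {N : ℕ} (i : Fin N) : (rho N).1 i = (N : ℝ) - (i : ℕ) := rfl

/-- The action on regular points is free, and `rho` is a regular point with integer coordinates, so
a group element is known from its action on that one vector. Identities between reflections thereby
reduce to linear algebra. -/
theorem weyl_ext {N : ℕ} {v w : WeylGroup N} (h : ∀ y : Fin N → ℤ, act v y = act w y) :
    v = w := by
  have hcast : ∀ (u : WeylGroup N) (y : Fin N → ℤ),
      act u (fun k => (y k : ℝ)) = fun k => ((act u y k : ℤ) : ℝ) := by
    intro u y
    funext k
    simp only [act]
    split_ifs <;> push_cast <;> rfl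
  have hr : (fun k : Fin N => (((N : ℤ) - (k : ℕ) : ℤ) : ℝ)) = (rho N).1 := by
    funext k
    rw [rho_apply]
    push_cast
    rfl
  have h1 : v • rho N = w • rho N := by
    refine Subtype.ext ?_
    rw [coe_smul, coe_smul, ← hr, hcast, hcast, h]
  have h2 : (w⁻¹ * v) • rho N = rho N := by rw [mul_smul, h1, inv_smul_smul]
  exact (inv_mul_eq_one.1 (regular_free h2)).symm

/-! ### Reflections -/

/-- The number `2 / (α · α)`, for a root `α`. -/
def coef {N : ℕ} (a : Fin N → ℤ) : ℤ := if a ⬝ᵥ a = 1 then 2 else 1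

theorem coef_mul_sq {N : ℕ} {a : Fin N → ℤ} (ha : a ∈ roots N) : coef a * (a ⬝ᵥ a) = 2 := by
  rcases mem_roots.1 ha with h | h <;> simp [coef, h]

theorem coef_neg {N : ℕ} (a : Fin N → ℤ) : coef (-a) = coef a := by simp [coef]

theorem coef_act {N : ℕ} (w : WeylGroup N) (a : Fin N → ℤ) : coef (act w a) = coef a := by
  simp [coef, act_dotProduct]

theorem act_flip_eq {N : ℕ} (i : Fin N) (ε : ℤˣ) (y : Fin N → ℤ) :
    act (flip i) y = y - (coef (Pi.single i (ε : ℤ)) * (Pi.single i (ε : ℤ) ⬝ᵥ y)) •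
      (Pi.single i (ε : ℤ) : Fin N → ℤ) := by
  rw [act_flip]
  funext k
  rcases Int.units_eq_one_or ε with rfl | rfl <;> by_cases hk : k = i
  all_goals first | subst hk | skip
  all_goals simp [coef, *]
  all_goals ring

theorem act_exch_eq {N : ℕ} {i j : Fin N} (hij : i ≠ j) (ε : ℤˣ) (y : Fin N → ℤ) :
    act (exch i j) y =
      y - (coef (Pi.single i (ε : ℤ) + Pi.single j ((-ε : ℤˣ) : ℤ)) *
        ((Pi.single i (ε : ℤ) + Pi.single j ((-ε : ℤˣ) : ℤ)) ⬝ᵥ y)) •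
      (Pi.single i (ε : ℤ) + Pi.single j ((-ε : ℤˣ) : ℤ) : Fin N → ℤ) := by
  rw [act_exch]
  funext k
  rcases Int.units_eq_one_or ε with rfl | rfl <;> by_cases hk : k = i <;> by_cases hk' : k = j
  all_goals first | subst hk | skip
  all_goals first | subst hk' | skip
  all_goals simp [coef, hij.symm, Equiv.swap_apply_of_ne_of_ne, *] at *

theorem act_exchTilde_eq {N : ℕ} {i j : Fin N} (hij : i ≠ j) (ε : ℤˣ) (y : Fin N → ℤ) :
    act (exchTilde i j) y =
      y - (coef (Pi.single i (ε : ℤ) + Pi.single j (ε : ℤ)) *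
        ((Pi.single i (ε : ℤ) + Pi.single j (ε : ℤ)) ⬝ᵥ y)) •
      (Pi.single i (ε : ℤ) + Pi.single j (ε : ℤ) : Fin N → ℤ) := by
  rw [exchTilde, act_mul, act_mul, act_exch, act_flip, act_flip]
  funext k
  rcases Int.units_eq_one_or ε with rfl | rfl <;> by_cases hk : k = i <;> by_cases hk' : k = j
  all_goals first | subst hk | skip
  all_goals first | subst hk' | skip
  all_goals simp [coef, hij.symm, Equiv.swap_apply_of_ne_of_ne, *] at *

theorem exists_reflection {N : ℕ} {a : Fin N → ℤ} (ha : a ∈ roots N) :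
    ∃ w : WeylGroup N, ∀ y : Fin N → ℤ, act w y = y - (coef a * (a ⬝ᵥ y)) • a := by
  rcases mem_roots.1 ha with h | h
  · obtain ⟨i, ε, rfl⟩ := exists_of_sq_eq_one h
    exact ⟨_, act_flip_eq i ε⟩
  · obtain ⟨i, j, ε, δ, hij, rfl⟩ := exists_of_sq_eq_two h
    obtain rfl | rfl : δ = ε ∨ δ = -ε := by
      rcases Int.units_eq_one_or ε with rfl | rfl <;>
        rcases Int.units_eq_one_or δ with rfl | rfl <;> simp
    · exact ⟨_, act_exchTilde_eq hij δ⟩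
    · exact ⟨_, act_exch_eq hij ε⟩

/-- The reflection in the root `α`, as an element of the Weyl group. -/
def reflection {N : ℕ} (a : Fin N → ℤ) : WeylGroup N :=
  Classical.epsilon fun w => ∀ y : Fin N → ℤ, act w y = y - (coef a * (a ⬝ᵥ y)) • a

theorem act_reflection {N : ℕ} {a : Fin N → ℤ} (ha : a ∈ roots N) (y : Fin N → ℤ) :
    act (reflection a) y = y - (coef a * (a ⬝ᵥ y)) • a :=
  Classical.epsilon_spec (exists_reflection ha) y

/-- The predicate from which `reflection` is chosen is even in the vector, so the two choices are
literally the same and no root hypothesis is needed. -/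
theorem reflection_neg {N : ℕ} (a : Fin N → ℤ) : reflection (-a) = reflection a := by
  unfold reflection
  congr 1
  funext w
  simp only [coef_neg, neg_dotProduct, mul_neg, neg_smul, smul_neg, neg_neg]

theorem eq_reflection {N : ℕ} {a : Fin N → ℤ} (ha : a ∈ roots N) {w : WeylGroup N}
    (h : ∀ y : Fin N → ℤ, act w y = y - (coef a * (a ⬝ᵥ y)) • a) : reflection a = w :=
  weyl_ext fun y => by rw [act_reflection ha, h]

theorem mul_reflection {N : ℕ} (w : WeylGroup N) {a : Fin N → ℤ} (ha : a ∈ roots N) :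
    w * reflection a = reflection (act w a) * w :=
  weyl_ext fun y => by
    rw [act_mul, act_mul, act_reflection ha, act_reflection ((act_mem_roots w).2 ha), act_sub,
      act_smul, coef_act, act_dotProduct]

theorem reflection_mul_self {N : ℕ} {a : Fin N → ℤ} (ha : a ∈ roots N) :
    reflection a * reflection a = 1 :=
  weyl_ext fun y => by
    rw [act_mul, act_reflection ha, act_reflection ha, act_one, dotProduct_sub, dotProduct_smul,
      sub_sub, ← add_smul]
    have h : coef a * (a ⬝ᵥ y) + coef a * (a ⬝ᵥ y - (coef a * (a ⬝ᵥ y)) • (a ⬝ᵥ a)) = 0 := by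
      rw [smul_eq_mul]
      linear_combination (-coef a * (a ⬝ᵥ y)) * coef_mul_sq ha
    rw [h, zero_smul, sub_zero]

theorem reflection_inv {N : ℕ} {a : Fin N → ℤ} (ha : a ∈ roots N) :
    (reflection a)⁻¹ = reflection a :=
  inv_eq_of_mul_eq_one_left (reflection_mul_self ha)

theorem single_mem_roots {N : ℕ} (i : Fin N) (ε : ℤˣ) : Pi.single i (ε : ℤ) ∈ roots N := by
  refine mem_roots.2 (Or.inl ?_)
  rcases Int.units_eq_one_or ε with rfl | rfl <;> simp

theorem single_add_single_sq {N : ℕ} {i j : Fin N} (hij : i ≠ j) (ε δ : ℤˣ) :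
    ((Pi.single i (ε : ℤ) + Pi.single j (δ : ℤ) : Fin N → ℤ) ⬝ᵥ
      (Pi.single i (ε : ℤ) + Pi.single j (δ : ℤ) : Fin N → ℤ)) = 2 := by
  rcases Int.units_eq_one_or ε with rfl | rfl <;>
    rcases Int.units_eq_one_or δ with rfl | rfl <;> simp [hij, hij.symm]

theorem single_add_single_mem_roots {N : ℕ} {i j : Fin N} (hij : i ≠ j) (ε δ : ℤˣ) :
    Pi.single i (ε : ℤ) + Pi.single j (δ : ℤ) ∈ roots N :=
  mem_roots.2 (Or.inr (single_add_single_sq hij ε δ))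

theorem reflection_flip {N : ℕ} (i : Fin N) :
    reflection (Pi.single i 1 : Fin N → ℤ) = flip i :=
  eq_reflection (single_mem_roots i 1) (act_flip_eq i 1)

theorem reflection_exchTilde {N : ℕ} {i j : Fin N} (hij : i ≠ j) :
    reflection (Pi.single i 1 + Pi.single j 1 : Fin N → ℤ) = exchTilde i j :=
  eq_reflection (single_add_single_mem_roots hij 1 1) (act_exchTilde_eq hij 1)

theorem reflection_exch {N : ℕ} {i j : Fin N} (hij : i ≠ j) :
    reflection (Pi.single i 1 - Pi.single j 1 : Fin N → ℤ) = exch i j := by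
  have h : (Pi.single i 1 - Pi.single j 1 : Fin N → ℤ) =
      Pi.single i ((1 : ℤˣ) : ℤ) + Pi.single j ((-1 : ℤˣ) : ℤ) := by
    rw [sub_eq_add_neg, ← Pi.single_neg]
    rfl
  rw [h]
  exact eq_reflection (single_add_single_mem_roots hij 1 (-1)) (act_exch_eq hij 1)

theorem parity_reflection {N : ℕ} {a : Fin N → ℤ} (ha : a ∈ roots N) :
    parity (reflection a) = -1 := by
  rcases mem_roots.1 ha with h | h
  · obtain ⟨i, ε, rfl⟩ := exists_of_sq_eq_one h
    rw [eq_reflection ha (act_flip_eq i ε), parity_flip]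
  · obtain ⟨i, j, ε, δ, hij, rfl⟩ := exists_of_sq_eq_two h
    obtain rfl | rfl : δ = ε ∨ δ = -ε := by
      rcases Int.units_eq_one_or ε with rfl | rfl <;>
        rcases Int.units_eq_one_or δ with rfl | rfl <;> simp
    · rw [eq_reflection ha (act_exchTilde_eq hij δ), exchTilde, map_mul, map_mul, parity_flip,
        parity_flip, parity_exch hij]
      rfl
    · rw [eq_reflection ha (act_exch_eq hij ε), parity_exch hij]

/-! ### Sums over the roots -/

theorem single_add_single_injective {N : ℕ} {i j k l : Fin N} (hij : i < j) (hkl : k < l)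
    {ε δ ε' δ' : ℤˣ}
    (h : (Pi.single i (ε : ℤ) + Pi.single j (δ : ℤ) : Fin N → ℤ) =
      Pi.single k (ε' : ℤ) + Pi.single l (δ' : ℤ)) : i = k ∧ j = l ∧ ε = ε' ∧ δ = δ' := by
  have h1 : i = k ∨ i = l := by
    by_contra! hne
    have := congrFun h i
    simp [hij.ne, hne.1, hne.2] at this
  have h2 : j = k ∨ j = l := by
    by_contra! hne
    have := congrFun h j
    simp [hij.ne', hne.1, hne.2] at this
  have h3 : i = k ∧ j = l := by
    rcases h1 with rfl | rfl <;> rcases h2 with rfl | rfl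
    · exact absurd hij (lt_irrefl _)
    · exact ⟨rfl, rfl⟩
    · exact absurd (hij.trans hkl) (lt_irrefl _)
    · exact absurd hij (lt_irrefl _)
  obtain ⟨rfl, rfl⟩ := h3
  refine ⟨rfl, rfl, Units.ext ?_, Units.ext ?_⟩
  · simpa [hij.ne] using congrFun h i
  · simpa [hij.ne'] using congrFun h j

theorem sum_int_units {M : Type*} [AddCommMonoid M] (f : ℤˣ → M) :
    ∑ ε, f ε = f 1 + f (-1) := by
  rw [UnitsInt.univ, Finset.sum_pair (by decide)]

theorem sum_short_roots {N : ℕ} {M : Type*} [AddCommMonoid M] (F : (Fin N → ℤ) → M)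
    (hF : ∀ a, F (-a) = F a) :
    ∑ a ∈ roots N with a ⬝ᵥ a = 1, F a =
      ∑ i, (F (Pi.single i 1) + F (Pi.single i 1)) := by
  have h : ∑ a ∈ roots N with a ⬝ᵥ a = 1, F a =
      ∑ p : Fin N × ℤˣ, F (Pi.single p.1 (p.2 : ℤ)) := by
    symm
    refine Finset.sum_nbij (fun p => Pi.single p.1 (p.2 : ℤ)) ?_ ?_ ?_ (fun _ _ => rfl)
    · intro p _
      refine Finset.mem_filter.2 ⟨single_mem_roots p.1 p.2, ?_⟩
      rcases Int.units_eq_one_or p.2 with h | h <;> simp [h]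
    · rintro ⟨i, ε⟩ _ ⟨j, δ⟩ _ h
      have h1 := congrFun h i
      by_cases hij : i = j
      · subst hij
        simp only [Pi.single_eq_same] at h1
        rw [Units.ext h1]
      · simp [hij] at h1
    · intro a ha
      obtain ⟨i, ε, rfl⟩ := exists_of_sq_eq_one (Finset.mem_filter.1 ha).2
      exact ⟨(i, ε), by simp⟩
  rw [h, Fintype.sum_prod_type]
  refine Finset.sum_congr rfl fun i _ => ?_
  rw [sum_int_units]
  simp only [Units.val_one, Units.val_neg, Pi.single_neg, hF]

/-- Long roots are indexed by i < j and two signs. Evenness pairs the four signs into twice one term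
symmetric in i and j, and this double is spread over the ordered pairs (i, j) and (j, i). -/
theorem sum_long_roots {N : ℕ} {M : Type*} [AddCommMonoid M] (F : (Fin N → ℤ) → M)
    (hF : ∀ a, F (-a) = F a) :
    ∑ a ∈ roots N with ¬ a ⬝ᵥ a = 1, F a =
      ∑ i, ∑ j with j ≠ i, (F (Pi.single i 1 - Pi.single j 1) +
        F (Pi.single i 1 + Pi.single j 1)) := by
  set X : Fin N → Fin N → M := fun i j =>
    F (Pi.single i 1 - Pi.single j 1) + F (Pi.single i 1 + Pi.single j 1) with hX
  have hXs : ∀ i j, X i j = X j i := by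
    intro i j
    simp only [hX]
    rw [← hF (Pi.single i 1 - Pi.single j 1), neg_sub, add_comm (Pi.single i 1)]
  have h : ∑ a ∈ roots N with ¬ a ⬝ᵥ a = 1, F a =
      ∑ p ∈ (Finset.univ : Finset ((Fin N × Fin N) × (ℤˣ × ℤˣ))) with p.1.1 < p.1.2,
        F (Pi.single p.1.1 (p.2.1 : ℤ) + Pi.single p.1.2 (p.2.2 : ℤ)) := by
    symm
    refine Finset.sum_nbij
      (fun p => Pi.single p.1.1 (p.2.1 : ℤ) + Pi.single p.1.2 (p.2.2 : ℤ)) ?_ ?_ ?_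
      (fun _ _ => rfl)
    · intro p hp
      have hlt := (Finset.mem_filter.1 hp).2
      refine Finset.mem_filter.2 ⟨single_add_single_mem_roots hlt.ne _ _, ?_⟩
      rw [single_add_single_sq hlt.ne]
      norm_num
    · rintro ⟨⟨i, j⟩, ε, δ⟩ hp ⟨⟨k, l⟩, ε', δ'⟩ hp' h
      have h1 : i < j := (Finset.mem_filter.1 hp).2
      have h2 : k < l := (Finset.mem_filter.1 hp').2
      obtain ⟨rfl, rfl, rfl, rfl⟩ := single_add_single_injective h1 h2 h
      rfl
    · intro a ha
      obtain ⟨ha1, ha2⟩ := Finset.mem_filter.1 ha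
      obtain ⟨i, j, ε, δ, hij, rfl⟩ :=
        exists_of_sq_eq_two ((mem_roots.1 ha1).resolve_left ha2)
      rcases lt_or_gt_of_ne hij with hlt | hlt
      · exact ⟨((i, j), ε, δ), by simpa using hlt, rfl⟩
      · exact ⟨((j, i), δ, ε), by simpa using hlt, add_comm _ _⟩
  have h' : ∑ a ∈ roots N with ¬ a ⬝ᵥ a = 1, F a =
      ∑ i, ∑ j with i < j, (X i j + X i j) := by
    rw [h, Finset.sum_filter, Fintype.sum_prod_type, Fintype.sum_prod_type]
    refine Finset.sum_congr rfl fun i _ => ?_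
    rw [Finset.sum_filter]
    refine Finset.sum_congr rfl fun j _ => ?_
    by_cases hij : i < j
    · simp only [hij, if_true, Fintype.sum_prod_type, sum_int_units, Units.val_one, Units.val_neg,
        Pi.single_neg, hX]
      have e1 : (-Pi.single i 1 + Pi.single j 1 : Fin N → ℤ) =
          -(Pi.single i 1 - Pi.single j 1) := by abel
      have e2 : (-Pi.single i 1 + -Pi.single j 1 : Fin N → ℤ) =
          -(Pi.single i 1 + Pi.single j 1) := by abel
      rw [e1, e2, hF, hF, ← sub_eq_add_neg]
      abel
    · simp [hij]
  have h2 : ∀ i j, (if j ≠ i then X i j else 0) =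
      (if i < j then X i j else 0) + (if j < i then X i j else 0) := by
    intro i j
    rcases lt_trichotomy i j with hij | rfl | hij
    · simp [hij, hij.ne', hij.not_gt]
    · simp
    · simp [hij, hij.ne, hij.not_gt]
  rw [h']
  change _ = ∑ i, ∑ j with j ≠ i, X i j
  simp only [Finset.sum_filter, h2, Finset.sum_add_distrib]
  have h3 : ∑ i, ∑ j, (if j < i then X i j else 0) = ∑ i, ∑ j, (if i < j then X i j else 0) := by
    rw [Finset.sum_comm]
    refine Finset.sum_congr rfl fun i _ => Finset.sum_congr rfl fun j _ => ?_
    rw [hXs]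
  rw [h3]

theorem sum_roots {N : ℕ} {M : Type*} [AddCommMonoid M] (F : (Fin N → ℤ) → M)
    (hF : ∀ a, F (-a) = F a) :
    ∑ a ∈ roots N, F a = ∑ i, (F (Pi.single i 1) + F (Pi.single i 1)) +
      ∑ i, ∑ j with j ≠ i, (F (Pi.single i 1 - Pi.single j 1) +
        F (Pi.single i 1 + Pi.single j 1)) := by
  rw [← sum_short_roots F hF, ← sum_long_roots F hF, Finset.sum_filter_add_sum_filter_not]

/-! ### Pairs of roots -/

/-- The map `(α, β) ↦ (-s_α β, α)` on pairs of roots, which preserves the product `s_α s_β`. -/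
def rotate {N : ℕ} (p : (Fin N → ℤ) × (Fin N → ℤ)) : (Fin N → ℤ) × (Fin N → ℤ) :=
  (-act (reflection p.1) p.2, p.1)

theorem rotate_mem {N : ℕ} {p : (Fin N → ℤ) × (Fin N → ℤ)} (hp : p ∈ roots N ×ˢ roots N) :
    rotate p ∈ roots N ×ˢ roots N := by
  rw [Finset.mem_product] at hp ⊢
  exact ⟨neg_mem_roots.2 ((act_mem_roots _).2 hp.2), hp.1⟩

theorem rotate_injective {N : ℕ} : Function.Injective (rotate (N := N)) := by
  rintro ⟨a, b⟩ ⟨a', b'⟩ h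
  simp only [rotate, Prod.mk.injEq, neg_inj] at h
  obtain ⟨h1, rfl⟩ := h
  have h2 := congrArg (act (reflection a)⁻¹) h1
  rw [← act_mul, ← act_mul, inv_mul_cancel, act_one, act_one] at h2
  rw [h2]

theorem rotate_eq {N : ℕ} {a b : Fin N → ℤ} (ha : a ∈ roots N) :
    rotate (a, b) = ((coef a * (a ⬝ᵥ b)) • a - b, a) := by
  simp only [rotate, act_reflection ha, neg_sub]

theorem rotate_dotProduct {N : ℕ} {p : (Fin N → ℤ) × (Fin N → ℤ)} (hp : p.1 ∈ roots N) :
    (rotate p).1 ⬝ᵥ (rotate p).2 = p.1 ⬝ᵥ p.2 := by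
  have h := act_dotProduct (reflection p.1) p.1 p.2
  have h1 : act (reflection p.1) p.1 = -p.1 := by
    rw [act_reflection hp, coef_mul_sq hp, two_smul]
    abel
  rw [h1] at h
  rw [← h, rotate, neg_dotProduct, neg_dotProduct, dotProduct_comm]

/-- With γ = s_α β one has s_γ = s_α s_β s_α, hence s_γ s_α = s_α s_β; the sign in `rotate` does not
affect the reflection. -/
theorem reflection_rotate {N : ℕ} {p : (Fin N → ℤ) × (Fin N → ℤ)} (hp : p.2 ∈ roots N) :
    reflection (rotate p).1 * reflection (rotate p).2 = reflection p.1 * reflection p.2 := by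
  rw [rotate, reflection_neg, ← mul_reflection _ hp]

/-- Averaging: an injection of a finite set into itself permutes it, so replacing f by its k-th
translate leaves the sum weighted by the invariant D unchanged. Adding m translates gives m times
the sum. No periodicity of φ is required. -/
theorem sum_eq_zero_of_orbit {ι : Type*} (S : Finset ι) (φ : ι → ι)
    (hφ : ∀ p ∈ S, φ p ∈ S) (hinj : Function.Injective φ) (D f : ι → ℝ)
    (hD : ∀ p ∈ S, D (φ p) = D p) (m : ℕ) (hm : m ≠ 0)
    (hf : ∀ p ∈ S, ∑ k ∈ Finset.range m, f (φ^[k] p) = 0) : ∑ p ∈ S, D p * f p = 0 := by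
  have hmem : ∀ k, ∀ p ∈ S, φ^[k] p ∈ S := by
    intro k
    induction k with
    | zero => exact fun p hp => hp
    | succ k ih => exact fun p hp => by rw [Function.iterate_succ_apply]; exact ih _ (hφ p hp)
  have hDk : ∀ k, ∀ p ∈ S, D (φ^[k] p) = D p := by
    intro k
    induction k with
    | zero => exact fun p _ => rfl
    | succ k ih =>
      exact fun p hp => by rw [Function.iterate_succ_apply, ih _ (hφ p hp), hD p hp]
  have hk : ∀ k, ∑ p ∈ S, D p * f (φ^[k] p) = ∑ p ∈ S, D p * f p := by
    intro k
    classical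
    have himg : Finset.image (φ^[k]) S = S :=
      Finset.eq_of_subset_of_card_le
        (Finset.image_subset_iff.2 (hmem k))
        (Finset.card_image_of_injective S (hinj.iterate k)).ge
    conv_rhs => rw [← himg, Finset.sum_image (hinj.iterate k).injOn]
    exact Finset.sum_congr rfl fun p hp => by rw [hDk k p hp]
  have h1 : ∑ k ∈ Finset.range m, ∑ p ∈ S, D p * f (φ^[k] p) = 0 := by
    rw [Finset.sum_comm]
    refine Finset.sum_eq_zero fun p hp => ?_
    rw [← Finset.mul_sum, hf p hp, mul_zero]
  simp only [hk, Finset.sum_const, Finset.card_range, nsmul_eq_mul] at h1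
  exact (mul_eq_zero.1 h1).resolve_left (by exact_mod_cast hm)

theorem sq_sub_smul {N : ℕ} (a b : Fin N → ℤ) (n : ℤ) :
    (a - n • b) ⬝ᵥ (a - n • b) = a ⬝ᵥ a - 2 * n * (a ⬝ᵥ b) + n ^ 2 * (b ⬝ᵥ b) := by
  simp only [sub_dotProduct, dotProduct_sub, smul_dotProduct, dotProduct_smul, smul_eq_mul,
    dotProduct_comm b a]
  ring

/-- Cauchy–Schwarz with its equality case. Proportional roots must be equal up to sign, because for
squared lengths 1 and 2 equality would make 2 the square of an integer. -/
theorem sq_dotProduct_lt_or {N : ℕ} {a b : Fin N → ℤ} (ha : a ∈ roots N) (hb : b ∈ roots N) :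
    (a ⬝ᵥ b) ^ 2 < (a ⬝ᵥ a) * (b ⬝ᵥ b) ∨ b = a ∨ b = -a := by
  -- This vector is a · a times the component of b orthogonal to a.
  have hpos : 0 ≤ ((a ⬝ᵥ a) • b - (a ⬝ᵥ b) • a) ⬝ᵥ ((a ⬝ᵥ a) • b - (a ⬝ᵥ b) • a) :=
    Finset.sum_nonneg fun k _ => mul_self_nonneg _
  have hid : ((a ⬝ᵥ a) • b - (a ⬝ᵥ b) • a) ⬝ᵥ ((a ⬝ᵥ a) • b - (a ⬝ᵥ b) • a) =
      (a ⬝ᵥ a) * ((a ⬝ᵥ a) * (b ⬝ᵥ b) - (a ⬝ᵥ b) ^ 2) := by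
    simp only [sub_dotProduct, dotProduct_sub, smul_dotProduct, dotProduct_smul, smul_eq_mul,
      dotProduct_comm b a]
    ring
  have hqa : 0 < a ⬝ᵥ a := by rcases mem_roots.1 ha with h | h <;> omega
  rw [hid] at hpos
  have hle : (a ⬝ᵥ b) ^ 2 ≤ (a ⬝ᵥ a) * (b ⬝ᵥ b) := by
    have := nonneg_of_mul_nonneg_right hpos hqa
    linarith
  rcases hle.lt_or_eq with h | h
  · exact Or.inl h
  right
  have hz : (a ⬝ᵥ a) • b = (a ⬝ᵥ b) • a := by
    rw [← sub_eq_zero, ← dotProduct_self_eq_zero, hid, h]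
    ring
  have key : a ⬝ᵥ b = a ⬝ᵥ a ∨ a ⬝ᵥ b = -(a ⬝ᵥ a) := by
    have hab : b ⬝ᵥ b = a ⬝ᵥ a := by
      rcases mem_roots.1 ha with h1 | h1 <;> rcases mem_roots.1 hb with h2 | h2 <;>
        rw [h1, h2] at h ⊢
      all_goals
        exfalso
        have : a ⬝ᵥ b ≤ 1 := by nlinarith
        have : -1 ≤ a ⬝ᵥ b := by nlinarith
        interval_cases a ⬝ᵥ b <;> omega
    rw [hab, ← sq] at h
    exact sq_eq_sq_iff_eq_or_eq_neg.1 h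
  rcases key with h1 | h1
  · left
    rw [h1] at hz
    funext k
    exact mul_left_cancel₀ hqa.ne' (congrFun hz k)
  · right
    rw [h1] at hz
    funext k
    have := congrFun hz k
    simp only [Pi.smul_apply, smul_eq_mul] at this
    refine mul_left_cancel₀ hqa.ne' ?_
    rw [this, Pi.neg_apply]
    ring

theorem rotate_neg_right {N : ℕ} (a b : Fin N → ℤ) :
    rotate (a, -b) = (-(rotate (a, b)).1, a) := by
  simp only [rotate, act_neg]

theorem rotate_neg_left {N : ℕ} (a b : Fin N → ℤ) :
    rotate (-a, b) = ((rotate (a, b)).1, -a) := by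
  simp only [rotate, reflection_neg]

/-- Changing the sign of either root only changes signs along the orbit, which an even f does not
see. This reduces negative inner products to positive ones. -/
theorem iterate_rotate_even {N : ℕ} {f : (Fin N → ℤ) × (Fin N → ℤ) → ℝ}
    (hf1 : ∀ a ∈ roots N, ∀ b ∈ roots N, f (-a, b) = f (a, b))
    (hf2 : ∀ a ∈ roots N, ∀ b ∈ roots N, f (a, -b) = f (a, b)) (k : ℕ) :
    ∀ a ∈ roots N, ∀ b ∈ roots N,
      f (rotate^[k] (-a, b)) = f (rotate^[k] (a, b)) ∧
        f (rotate^[k] (a, -b)) = f (rotate^[k] (a, b)) := by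
  induction k with
  | zero => exact fun a ha b hb => ⟨hf1 a ha b hb, hf2 a ha b hb⟩
  | succ k ih =>
    intro a ha b hb
    have hg : (rotate (a, b)).1 ∈ roots N :=
      (Finset.mem_product.1 (rotate_mem (Finset.mem_product.2 ⟨ha, hb⟩))).1
    simp only [Function.iterate_succ_apply, rotate_neg_left, rotate_neg_right]
    exact ⟨(ih _ hg a ha).2, (ih _ hg a ha).1⟩

theorem coef_eq_two {N : ℕ} {a : Fin N → ℤ} (h : a ⬝ᵥ a = 1) : coef a = 2 := if_pos h

theorem coef_eq_one {N : ℕ} {a : Fin N → ℤ} (h : a ⬝ᵥ a = 2) : coef a = 1 :=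
  if_neg (by rw [h]; norm_num)

theorem rotate_eq_of {N : ℕ} {a b c : Fin N → ℤ} {n m : ℤ} (ha : a ∈ roots N) (hn : coef a = n)
    (hm : a ⬝ᵥ b = m) (hc : (n * m) • a - b = c) : rotate (a, b) = (c, a) := by
  rw [rotate_eq ha, hn, hm, hc]

/-- A sum over pairs of nonproportional roots vanishes as soon as the sums over the orbits of
`rotate` vanish in each plane spanned by two roots; here `F γ α β` is used with `γ = -s_α β`. -/
theorem sum_pairs_eq_zero {N : ℕ} (D : (Fin N → ℤ) × (Fin N → ℤ) → ℝ)
    (hD : ∀ p ∈ roots N ×ˢ roots N, D (rotate p) = D p)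
    (F : (Fin N → ℤ) → (Fin N → ℤ) → (Fin N → ℤ) → ℝ)
    (hF1 : ∀ a ∈ roots N, ∀ b ∈ roots N, ∀ c ∈ roots N, F c (-a) b = F c a b)
    (hF2 : ∀ a ∈ roots N, ∀ b ∈ roots N, ∀ c ∈ roots N, F (-c) a (-b) = F c a b)
    (h2 : ∀ a ∈ roots N, ∀ b ∈ roots N, a ⬝ᵥ b = 0 → F (-b) a b + F (-a) (-b) a = 0)
    (h3 : ∀ a ∈ roots N, ∀ b ∈ roots N, a - b ∈ roots N → a ⬝ᵥ a = 2 → b ⬝ᵥ b = 2 →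
      (a - b) ⬝ᵥ (a - b) = 2 →
      F (a - b) a b + F (-b) (a - b) a + F (-a) (-b) (a - b) = 0)
    (h4 : ∀ a ∈ roots N, ∀ b ∈ roots N, a - b ∈ roots N → a - (2 : ℤ) • b ∈ roots N →
      a ⬝ᵥ a = 2 → b ⬝ᵥ b = 1 → (a - b) ⬝ᵥ (a - b) = 1 →
      (a - (2 : ℤ) • b) ⬝ᵥ (a - (2 : ℤ) • b) = 2 →
      F (a - b) a b + F (a - (2 : ℤ) • b) (a - b) a + F (-b) (a - (2 : ℤ) • b) (a - b) +
        F (-a) (-b) (a - (2 : ℤ) • b) = 0) :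
    ∑ p ∈ roots N ×ˢ roots N with (p.1 ⬝ᵥ p.2) ^ 2 < (p.1 ⬝ᵥ p.1) * (p.2 ⬝ᵥ p.2),
      D p * F (rotate p).1 p.1 p.2 = 0 := by
  set f : (Fin N → ℤ) × (Fin N → ℤ) → ℝ := fun p => F (rotate p).1 p.1 p.2 with hf
  have hmem : ∀ a ∈ roots N, ∀ b ∈ roots N, (rotate (a, b)).1 ∈ roots N := fun a ha b hb =>
    (Finset.mem_product.1 (rotate_mem (Finset.mem_product.2 ⟨ha, hb⟩))).1
  have hf1 : ∀ a ∈ roots N, ∀ b ∈ roots N, f (-a, b) = f (a, b) := by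
    intro a ha b hb
    simp only [hf, rotate_neg_left]
    exact hF1 a ha b hb _ (hmem a ha b hb)
  have hf2 : ∀ a ∈ roots N, ∀ b ∈ roots N, f (a, -b) = f (a, b) := by
    intro a ha b hb
    simp only [hf, rotate_neg_right]
    exact hF2 a ha b hb _ (hmem a ha b hb)
  have hpm : ∀ m : ℕ, ∀ a ∈ roots N, ∀ b ∈ roots N,
      ∑ k ∈ Finset.range m, f (rotate^[k] (a, -b)) = ∑ k ∈ Finset.range m, f (rotate^[k] (a, b)) :=
    fun m a ha b hb => Finset.sum_congr rfl fun k _ => (iterate_rotate_even hf1 hf2 k a ha b hb).2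
  -- In each of the three classes below, m is the number of steps after which `rotate` takes (a, b)
  -- to (-a, -b): 2 for A₁×A₁, 3 for A₂ and 4 for B₂. By evenness the remaining half of the orbit
  -- would repeat the same terms.
  have key : ∀ (P : (Fin N → ℤ) × (Fin N → ℤ) → Prop) [DecidablePred P] (m : ℕ), m ≠ 0 →
      (∀ p ∈ roots N ×ˢ roots N, P p → P (rotate p)) →
      (∀ p ∈ roots N ×ˢ roots N, P p → ∑ k ∈ Finset.range m, f (rotate^[k] p) = 0) →
      ∑ p ∈ roots N ×ˢ roots N with P p, D p * f p = 0 := by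
    intro P _ m hm hP hsum
    refine sum_eq_zero_of_orbit _ rotate (fun p hp => ?_) rotate_injective D f (fun p hp => ?_) m
      hm (fun p hp => ?_)
    all_goals obtain ⟨hp1, hp2⟩ := Finset.mem_filter.1 hp
    · exact Finset.mem_filter.2 ⟨rotate_mem hp1, hP p hp1 hp2⟩
    · exact hD p hp1
    · exact hsum p hp1 hp2
  have hsq : ∀ p : (Fin N → ℤ) × (Fin N → ℤ), (rotate p).1 ⬝ᵥ (rotate p).1 = p.2 ⬝ᵥ p.2 := by
    intro p
    simp only [rotate, neg_dotProduct, dotProduct_neg, neg_neg, act_dotProduct]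
  have hsq2 : ∀ p : (Fin N → ℤ) × (Fin N → ℤ), (rotate p).2 = p.1 := fun _ => rfl
  have s2 : ∑ p ∈ roots N ×ˢ roots N with p.1 ⬝ᵥ p.2 = 0, D p * f p = 0 := by
    refine key _ 2 two_ne_zero (fun p hp h => ?_) (fun p hp h => ?_)
    · rw [rotate_dotProduct (Finset.mem_product.1 hp).1, h]
    · obtain ⟨a, b⟩ := p
      obtain ⟨ha, hb⟩ := Finset.mem_product.1 hp
      have h : a ⬝ᵥ b = 0 := h
      have e1 : rotate (a, b) = (-b, a) := rotate_eq_of ha rfl h (by simp)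
      have e2 : rotate (-b, a) = (-a, -b) :=
        rotate_eq_of (neg_mem_roots.2 hb) rfl
          (by rw [neg_dotProduct, dotProduct_comm, h, neg_zero]) (by simp)
      simp only [Finset.sum_range_succ, Finset.sum_range_zero, zero_add, Function.iterate_succ_apply,
        Function.iterate_zero_apply, e1, hf, e2]
      exact h2 a ha b hb h
  have s3 : ∑ p ∈ roots N ×ˢ roots N with p.1 ⬝ᵥ p.1 = 2 ∧ p.2 ⬝ᵥ p.2 = 2 ∧
      (p.1 ⬝ᵥ p.2) ^ 2 = 1, D p * f p = 0 := by
    have base : ∀ a ∈ roots N, ∀ b ∈ roots N, a ⬝ᵥ a = 2 → b ⬝ᵥ b = 2 → a ⬝ᵥ b = 1 →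
        ∑ k ∈ Finset.range 3, f (rotate^[k] (a, b)) = 0 := by
      intro a ha b hb qa qb h
      have h' : b ⬝ᵥ a = 1 := by rw [dotProduct_comm, h]
      have qc : (a - b) ⬝ᵥ (a - b) = 2 := by
        simp only [sub_dotProduct, dotProduct_sub, qa, qb, h, h']
        norm_num
      have hc : a - b ∈ roots N := mem_roots.2 (Or.inr qc)
      have e1 : rotate (a, b) = (a - b, a) :=
        rotate_eq_of ha (coef_eq_one qa) h (by module)
      have e2 : rotate (a - b, a) = (-b, a - b) :=
        rotate_eq_of (m := 1) hc (coef_eq_one qc)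
          (by norm_num [sub_dotProduct, qa, h']) (by module)
      have e3 : rotate (-b, a - b) = (-a, -b) :=
        rotate_eq_of (m := 1) (neg_mem_roots.2 hb) ((coef_neg b).trans (coef_eq_one qb))
          (by norm_num [neg_dotProduct, dotProduct_sub, qb, h']) (by module)
      simp only [Finset.sum_range_succ, Finset.sum_range_zero, zero_add, Function.iterate_succ_apply,
        Function.iterate_zero_apply, e1, hf, e2, e3]
      exact h3 a ha b hb hc qa qb qc
    refine key _ 3 three_ne_zero (fun p hp h => ?_) (fun p hp h => ?_)
    · rw [rotate_dotProduct (Finset.mem_product.1 hp).1, hsq, hsq2]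
      exact ⟨h.2.1, h.1, h.2.2⟩
    · obtain ⟨a, b⟩ := p
      obtain ⟨ha, hb⟩ := Finset.mem_product.1 hp
      obtain ⟨qa, qb, h⟩ := h
      rcases sq_eq_one_iff.1 h with h | h
      · exact base a ha b hb qa qb h
      · rw [← hpm 3 a ha b hb]
        exact base a ha (-b) (neg_mem_roots.2 hb) qa (by simpa using qb)
          (by rw [dotProduct_neg, h, neg_neg])
  have s4 : ∑ p ∈ roots N ×ˢ roots N with p.1 ⬝ᵥ p.1 + p.2 ⬝ᵥ p.2 = 3 ∧
      (p.1 ⬝ᵥ p.2) ^ 2 = 1, D p * f p = 0 := by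
    have base : ∀ a ∈ roots N, ∀ b ∈ roots N, a ⬝ᵥ a + b ⬝ᵥ b = 3 → a ⬝ᵥ b = 1 →
        ∑ k ∈ Finset.range 4, f (rotate^[k] (a, b)) = 0 := by
      intro a ha b hb qab h
      have h' : b ⬝ᵥ a = 1 := by rw [dotProduct_comm, h]
      rcases mem_roots.1 ha with qa | qa
      · have qb : b ⬝ᵥ b = 2 := by omega
        have qc : ((2 : ℤ) • a - b) ⬝ᵥ ((2 : ℤ) • a - b) = 2 := by
          simp only [sub_dotProduct, dotProduct_sub, smul_dotProduct, dotProduct_smul, smul_eq_mul,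
            qa, qb, h, h']
          norm_num
        have qd : (a - b) ⬝ᵥ (a - b) = 1 := by
          simp only [sub_dotProduct, dotProduct_sub, qa, qb, h, h']
          norm_num
        have hc : (2 : ℤ) • a - b ∈ roots N := mem_roots.2 (Or.inr qc)
        have hd : a - b ∈ roots N := mem_roots.2 (Or.inl qd)
        have e1 : rotate (a, b) = ((2 : ℤ) • a - b, a) :=
          rotate_eq_of ha (coef_eq_two qa) h (by module)
        have e2 : rotate ((2 : ℤ) • a - b, a) = (a - b, (2 : ℤ) • a - b) :=
          rotate_eq_of (m := 1) hc (coef_eq_one qc)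
            (by
              simp only [sub_dotProduct, smul_dotProduct, smul_eq_mul, qa, h']
              norm_num) (by module)
        have e3 : rotate (a - b, (2 : ℤ) • a - b) = (-b, a - b) :=
          rotate_eq_of (m := 1) hd (coef_eq_two qd)
            (by
              simp only [sub_dotProduct, dotProduct_sub, dotProduct_smul,
                smul_eq_mul, qa, qb, h, h']
              norm_num) (by module)
        have e4 : rotate (-b, a - b) = (-a, -b) :=
          rotate_eq_of (m := 1) (neg_mem_roots.2 hb) ((coef_neg b).trans (coef_eq_one qb))
            (by norm_num [neg_dotProduct, dotProduct_sub, qb, h']) (by module)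
        -- When a is the short root, the orbit is the one of (2a - b, a), whose first root is long,
        -- shifted by one step. So `h4` applies there, and its last term is the term of (a, b) up to
        -- signs, which `hF1` and `hF2` remove.
        have x1 : (2 : ℤ) • a - b - a = a - b := by module
        have x2 : (2 : ℤ) • a - b - (2 : ℤ) • a = -b := by module
        have := h4 _ hc a ha (by rwa [x1]) (by rw [x2]; exact neg_mem_roots.2 hb) qc qa
          (by rwa [x1]) (by rw [x2]; simpa using qb)
        rw [x1, x2, hF1 a ha _ (neg_mem_roots.2 hb) _ (neg_mem_roots.2 hc),
          hF2 a ha b hb _ hc] at this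
        simp only [Finset.sum_range_succ, Finset.sum_range_zero, zero_add,
          Function.iterate_succ_apply, Function.iterate_zero_apply, e1, hf, e2, e3, e4]
        linarith
      · have qb : b ⬝ᵥ b = 1 := by omega
        have qc : (a - b) ⬝ᵥ (a - b) = 1 := by
          simp only [sub_dotProduct, dotProduct_sub, qa, qb, h, h']
          norm_num
        have qd : (a - (2 : ℤ) • b) ⬝ᵥ (a - (2 : ℤ) • b) = 2 := by
          simp only [sub_dotProduct, dotProduct_sub, smul_dotProduct, dotProduct_smul, smul_eq_mul,
            qa, qb, h, h']
          norm_num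
        have hc : a - b ∈ roots N := mem_roots.2 (Or.inl qc)
        have hd : a - (2 : ℤ) • b ∈ roots N := mem_roots.2 (Or.inr qd)
        have e1 : rotate (a, b) = (a - b, a) :=
          rotate_eq_of ha (coef_eq_one qa) h (by module)
        have e2 : rotate (a - b, a) = (a - (2 : ℤ) • b, a - b) :=
          rotate_eq_of (m := 1) hc (coef_eq_two qc)
            (by norm_num [sub_dotProduct, qa, h']) (by module)
        have e3 : rotate (a - (2 : ℤ) • b, a - b) = (-b, a - (2 : ℤ) • b) :=
          rotate_eq_of (m := 1) hd (coef_eq_one qd)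
            (by
              simp only [sub_dotProduct, dotProduct_sub, smul_dotProduct,
                smul_eq_mul, qa, qb, h, h']
              norm_num) (by module)
        have e4 : rotate (-b, a - (2 : ℤ) • b) = (-a, -b) :=
          rotate_eq_of (m := 1) (neg_mem_roots.2 hb) ((coef_neg b).trans (coef_eq_two qb))
            (by
              simp only [neg_dotProduct, dotProduct_sub, dotProduct_smul, smul_eq_mul, qb, h']
              norm_num) (by module)
        simp only [Finset.sum_range_succ, Finset.sum_range_zero, zero_add,
          Function.iterate_succ_apply, Function.iterate_zero_apply, e1, hf, e2, e3, e4]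
        exact h4 a ha b hb hc hd qa qb qc qd
    refine key _ 4 four_ne_zero (fun p hp h => ?_) (fun p hp h => ?_)
    · rw [rotate_dotProduct (Finset.mem_product.1 hp).1, hsq, hsq2, add_comm]
      exact h
    · obtain ⟨a, b⟩ := p
      obtain ⟨ha, hb⟩ := Finset.mem_product.1 hp
      obtain ⟨qab, h⟩ := h
      rcases sq_eq_one_iff.1 h with h | h
      · exact base a ha b hb qab h
      · rw [← hpm 4 a ha b hb]
        exact base a ha (-b) (neg_mem_roots.2 hb) (by simpa using qab)
          (by rw [dotProduct_neg, h, neg_neg])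
  rw [Finset.sum_filter] at s2 s3 s4 ⊢
  refine Eq.trans ?_ (congrArg₂ (· + ·) s2 (congrArg₂ (· + ·) s3 s4) |>.trans (by norm_num))
  simp only [← Finset.sum_add_distrib]
  refine Finset.sum_congr rfl fun p hp => ?_
  obtain ⟨ha, hb⟩ := Finset.mem_product.1 hp
  -- Nonproportional roots have inner product 0 or ±1, so the three classes partition the pairs to
  -- be summed. Two short roots with inner product ±1 are proportional and belong to none of the
  -- classes.
  have hle : p.1 ⬝ᵥ p.2 = 0 ∨ p.1 ⬝ᵥ p.2 = 1 ∨ p.1 ⬝ᵥ p.2 = -1 ∨ 4 ≤ (p.1 ⬝ᵥ p.2) ^ 2 := by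
    by_cases hu : (p.1 ⬝ᵥ p.2) ^ 2 < 4
    · have : p.1 ⬝ᵥ p.2 < 2 := by nlinarith
      have : -2 < p.1 ⬝ᵥ p.2 := by nlinarith
      omega
    · omega
  have hq : (p.1 ⬝ᵥ p.1 = 1 ∨ p.1 ⬝ᵥ p.1 = 2) ∧ (p.2 ⬝ᵥ p.2 = 1 ∨ p.2 ⬝ᵥ p.2 = 2) :=
    ⟨mem_roots.1 ha, mem_roots.1 hb⟩
  rcases hle with h | h | h | h
  · rcases hq with ⟨qa | qa, qb | qb⟩ <;> simp [qa, qb, h, hf]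
  · rcases hq with ⟨qa | qa, qb | qb⟩ <;> simp [qa, qb, h, hf]
  · rcases hq with ⟨qa | qa, qb | qb⟩ <;> simp [qa, qb, h, hf]
  · have h0 : p.1 ⬝ᵥ p.2 ≠ 0 := fun h0 => by rw [h0] at h; norm_num at h
    have h1 : (p.1 ⬝ᵥ p.2) ^ 2 ≠ 1 := fun h1 => by rw [h1] at h; norm_num at h
    have h2 : ¬ (p.1 ⬝ᵥ p.2) ^ 2 < (p.1 ⬝ᵥ p.1) * (p.2 ⬝ᵥ p.2) := by
      rcases hq with ⟨qa | qa, qb | qb⟩ <;> rw [qa, qb] <;> linarith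
    rw [if_neg h2, if_neg h0, if_neg (fun h => h1 h.2.2), if_neg (fun h => h1 h.2)]
    norm_num

/-! ### Hyperbolic identities -/

theorem coth_neg (t : ℝ) : coth (-t) = -coth t := by
  simp [coth, div_neg]

theorem csch2_neg (t : ℝ) : csch2 (-t) = csch2 t := by simp [csch2]

theorem sech2_neg (t : ℝ) : sech2 (-t) = sech2 t := by simp [sech2]

theorem coth_ne_zero {t : ℝ} (ht : t ≠ 0) : coth t ≠ 0 :=
  div_ne_zero (Real.cosh_pos t).ne' (Real.sinh_ne_zero.2 ht)

theorem csch2_eq {t : ℝ} (ht : t ≠ 0) : csch2 t = coth t ^ 2 - 1 := by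
  have h := Real.sinh_ne_zero.2 ht
  rw [csch2, coth]
  field_simp
  linarith [Real.cosh_sq t]

theorem tanh_eq (t : ℝ) : Real.tanh t = (coth t)⁻¹ := by
  rw [Real.tanh_eq_sinh_div_cosh, coth, inv_div]

theorem sech2_eq {t : ℝ} (ht : t ≠ 0) : sech2 t = 1 - ((coth t)⁻¹) ^ 2 := by
  have h := Real.sinh_ne_zero.2 ht
  have h' := (Real.cosh_pos t).ne'
  rw [sech2, coth]
  field_simp
  linarith [Real.cosh_sq t]

/-- The addition formula with denominators cleared; this is the A₂ relation for three roots a, b, a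
- b. -/
theorem coth_sub {s t : ℝ} (hs : s ≠ 0) (ht : t ≠ 0) (hst : s - t ≠ 0) :
    coth (s - t) * (coth t - coth s) = coth s * coth t - 1 := by
  have h1 := Real.sinh_ne_zero.2 hs
  have h2 := Real.sinh_ne_zero.2 ht
  have h3 := Real.sinh_ne_zero.2 hst
  simp only [coth]
  rw [Real.cosh_sub]
  rw [Real.sinh_sub] at h3 ⊢
  rw [div_mul_eq_mul_div, div_eq_iff h3]
  field_simp

theorem sign_of_ne_zero {r : ℝ} (hr : r ≠ 0) : Real.sign r = if 0 < r then 1 else -1 := by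
  rcases lt_or_gt_of_ne hr with h | h
  · rw [Real.sign_of_neg h, if_neg h.not_gt]
  · rw [Real.sign_of_pos h, if_pos h]

/-! ### Functions attached to the roots -/

/-- The odd function `coth (α · x)` for a long root `α`, and
`β coth (α · x) + β' tanh (α · x)` for a short one. -/
def rootCoth {N : ℕ} (β β' : ℝ) (a : Fin N → ℤ) (x : RegularPoint N) : ℝ :=
  if a ⬝ᵥ a = 1 then β * coth (pair a x.1) + β' * Real.tanh (pair a x.1) else coth (pair a x.1)

/-- The value at infinity of `rootCoth` in the positive chamber. -/
def rootSign {N : ℕ} (β β' : ℝ) (a : Fin N → ℤ) : ℝ :=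
  if a ⬝ᵥ a = 1 then (β + β') * Real.sign (pair a (rho N).1) else Real.sign (pair a (rho N).1)

/-- Minus the derivative of the profile of `rootCoth`, times the squared length of `α`. -/
def rootCsch {N : ℕ} (β β' : ℝ) (a : Fin N → ℤ) (x : RegularPoint N) : ℝ :=
  if a ⬝ᵥ a = 1 then β * csch2 (pair a x.1) - β' * sech2 (pair a x.1) else 2 * csch2 (pair a x.1)

theorem rootCoth_neg {N : ℕ} (β β' : ℝ) (a : Fin N → ℤ) (x : RegularPoint N) :
    rootCoth β β' (-a) x = -rootCoth β β' a x := by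
  simp only [rootCoth, neg_dotProduct, dotProduct_neg, neg_neg, pair_neg, coth_neg, Real.tanh_neg]
  split_ifs <;> ring

theorem rootSign_neg {N : ℕ} (β β' : ℝ) (a : Fin N → ℤ) :
    rootSign β β' (-a) = -rootSign β β' a := by
  simp only [rootSign, neg_dotProduct, dotProduct_neg, neg_neg, pair_neg,
    Real.sign_neg]
  split_ifs <;> ring

theorem rootCsch_neg {N : ℕ} (β β' : ℝ) (a : Fin N → ℤ) (x : RegularPoint N) :
    rootCsch β β' (-a) x = rootCsch β β' a x := by
  simp only [rootCsch, neg_dotProduct, dotProduct_neg, neg_neg, pair_neg, csch2_neg, sech2_neg]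

theorem rootCoth_inv_smul {N : ℕ} (β β' : ℝ) (a : Fin N → ℤ) (w : WeylGroup N)
    (x : RegularPoint N) : rootCoth β β' a (w⁻¹ • x) = rootCoth β β' (act w a) x := by
  simp only [rootCoth, pair_inv_smul, act_dotProduct]

theorem rootCsch_inv_smul {N : ℕ} (β β' : ℝ) (a : Fin N → ℤ) (w : WeylGroup N)
    (x : RegularPoint N) : rootCsch β β' a (w⁻¹ • x) = rootCsch β β' (act w a) x := by
  simp only [rootCsch, pair_inv_smul, act_dotProduct]

theorem rootCoth_A2 {N : ℕ} (β β' : ℝ) {a b : Fin N → ℤ} (ha : a ∈ roots N) (hb : b ∈ roots N)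
    (hc : a - b ∈ roots N) (qa : a ⬝ᵥ a = 2) (qb : b ⬝ᵥ b = 2)
    (qc : (a - b) ⬝ᵥ (a - b) = 2) (x : RegularPoint N) :
    rootCoth β β' (a - b) x * (rootCoth β β' b x - rootCoth β β' a x) =
      rootCoth β β' a x * rootCoth β β' b x - 1 := by
  have hab := pair_ne_zero hc x
  simp only [rootCoth, qa, qb, qc, OfNat.ofNat_ne_one, if_false]
  rw [pair_sub] at hab ⊢
  exact coth_sub (pair_ne_zero ha x) (pair_ne_zero hb x) hab

/-- The limit at infinity of `rootCoth_A2`, with the same constant. It is checked on the sign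
patterns compatible with additivity of the pairing with `rho`. -/
theorem rootSign_A2 {N : ℕ} (β β' : ℝ) {a b : Fin N → ℤ} (ha : a ∈ roots N) (hb : b ∈ roots N)
    (hc : a - b ∈ roots N) (qa : a ⬝ᵥ a = 2) (qb : b ⬝ᵥ b = 2)
    (qc : (a - b) ⬝ᵥ (a - b) = 2) :
    rootSign β β' (a - b) * (rootSign β β' b - rootSign β β' a) =
      rootSign β β' a * rootSign β β' b - 1 := by
  simp only [rootSign, qa, qb, qc, OfNat.ofNat_ne_one, if_false]
  rw [sign_of_ne_zero (pair_ne_zero ha _), sign_of_ne_zero (pair_ne_zero hb _),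
    sign_of_ne_zero (pair_ne_zero hc _), pair_sub]
  split_ifs <;> first | (exfalso; linarith) | norm_num

theorem rootCsch_long {N : ℕ} (β β' : ℝ) {a : Fin N → ℤ} (ha : a ∈ roots N)
    (qa : a ⬝ᵥ a = 2) (x : RegularPoint N) :
    rootCsch β β' a x = 2 * (rootCoth β β' a x ^ 2 - 1) := by
  simp only [rootCsch, rootCoth, qa, OfNat.ofNat_ne_one, if_false]
  rw [csch2_eq (pair_ne_zero ha x)]

/-- Since a = (a - b) + b and a - 2b = (a - b) - b, everything in a B₂ plane is a rational function
of A = coth(b · x) and B = coth((a - b) · x). The B₂ identities then become identities of rational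
functions. -/
theorem exists_B2_param {N : ℕ} (β β' : ℝ) {a b : Fin N → ℤ} (ha : a ∈ roots N) (hb : b ∈ roots N)
    (hc : a - b ∈ roots N) (hd : a - (2 : ℤ) • b ∈ roots N) (qa : a ⬝ᵥ a = 2) (qb : b ⬝ᵥ b = 1)
    (qc : (a - b) ⬝ᵥ (a - b) = 1) (qd : (a - (2 : ℤ) • b) ⬝ᵥ (a - (2 : ℤ) • b) = 2)
    (x : RegularPoint N) :
    ∃ A B : ℝ, A ≠ 0 ∧ B ≠ 0 ∧ A + B ≠ 0 ∧ B - A ≠ 0 ∧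
      rootCoth β β' a x = (1 + A * B) / (A + B) ∧
      rootCoth β β' (a - (2 : ℤ) • b) x = (1 - A * B) / (B - A) ∧
      rootCoth β β' b x = β * A + β' / A ∧ rootCoth β β' (a - b) x = β * B + β' / B ∧
      rootCsch β β' b x = β * (A ^ 2 - 1) - β' * (1 - 1 / A ^ 2) ∧
      rootCsch β β' (a - b) x = β * (B ^ 2 - 1) - β' * (1 - 1 / B ^ 2) := by
  have ha' := pair_ne_zero ha x
  have hb' := pair_ne_zero hb x
  have hc' := pair_ne_zero hc x
  have hd' := pair_ne_zero hd x
  have ea : pair a x.1 = pair (a - b) x.1 - -pair b x.1 := by rw [pair_sub]; ring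
  have ed : pair (a - (2 : ℤ) • b) x.1 = pair (a - b) x.1 - pair b x.1 := by
    rw [pair_sub, pair_sub, pair_smul]
    push_cast
    ring
  have h1 := coth_sub hc' (neg_ne_zero.2 hb') (ea ▸ ha')
  have h2 := coth_sub hc' hb' (ed ▸ hd')
  rw [← ea, coth_neg] at h1
  rw [← ed] at h2
  -- A = ±B would turn the addition formulas into B² = 1, whereas B² - 1 is sinh⁻² of a nonzero
  -- number.
  have h5 : coth (pair (a - b) x.1) ^ 2 - 1 ≠ 0 := by
    rw [← csch2_eq hc']
    exact one_div_ne_zero (pow_ne_zero 2 (Real.sinh_ne_zero.2 hc'))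
  have hAB : coth (pair b x.1) + coth (pair (a - b) x.1) ≠ 0 := by
    intro h0
    rw [eq_neg_of_add_eq_zero_left h0] at h1
    exact h5 (by linarith)
  have hBA : coth (pair (a - b) x.1) - coth (pair b x.1) ≠ 0 := by
    intro h0
    rw [sub_eq_zero.1 h0] at h2
    exact h5 (by rw [sub_eq_zero.1 h0]; linarith)
  refine ⟨coth (pair b x.1), coth (pair (a - b) x.1), coth_ne_zero hb', coth_ne_zero hc', hAB, hBA,
    ?_, ?_, ?_, ?_, ?_, ?_⟩
  · simp only [rootCoth, qa, OfNat.ofNat_ne_one, if_false]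
    rw [eq_div_iff hAB]
    linarith
  · simp only [rootCoth, qd, OfNat.ofNat_ne_one, if_false]
    rw [eq_div_iff hBA]
    linarith
  · simp only [rootCoth, qb, if_true, tanh_eq, div_eq_mul_inv]
  · simp only [rootCoth, qc, if_true, tanh_eq, div_eq_mul_inv]
  · simp only [rootCsch, qb, if_true, csch2_eq hb', sech2_eq hb', inv_pow, one_div]
  · simp only [rootCsch, qc, if_true, csch2_eq hc', sech2_eq hc', inv_pow, one_div]

theorem rootCoth_B2 {N : ℕ} (β β' : ℝ) {a b : Fin N → ℤ} (ha : a ∈ roots N) (hb : b ∈ roots N)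
    (hc : a - b ∈ roots N) (hd : a - (2 : ℤ) • b ∈ roots N) (qa : a ⬝ᵥ a = 2) (qb : b ⬝ᵥ b = 1)
    (qc : (a - b) ⬝ᵥ (a - b) = 1) (qd : (a - (2 : ℤ) • b) ⬝ᵥ (a - (2 : ℤ) • b) = 2)
    (x : RegularPoint N) :
    rootCoth β β' a x * (rootCoth β β' b x + rootCoth β β' (a - b) x) +
      rootCoth β β' (a - (2 : ℤ) • b) x * (rootCoth β β' (a - b) x - rootCoth β β' b x) =
      2 * (β + β') := by
  obtain ⟨A, B, hA, hB, hAB, hBA, e1, e2, e3, e4, -, -⟩ :=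
    exists_B2_param β β' ha hb hc hd qa qb qc qd x
  rw [e1, e2, e3, e4]
  field_simp
  ring

theorem rootSign_B2 {N : ℕ} (β β' : ℝ) {a b : Fin N → ℤ} (ha : a ∈ roots N) (hb : b ∈ roots N)
    (hc : a - b ∈ roots N) (hd : a - (2 : ℤ) • b ∈ roots N)
    (qa : a ⬝ᵥ a = 2) (qb : b ⬝ᵥ b = 1)
    (qc : (a - b) ⬝ᵥ (a - b) = 1) (qd : (a - (2 : ℤ) • b) ⬝ᵥ (a - (2 : ℤ) • b) = 2) :
    rootSign β β' a * (rootSign β β' b + rootSign β β' (a - b)) +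
      rootSign β β' (a - (2 : ℤ) • b) * (rootSign β β' (a - b) - rootSign β β' b) =
      2 * (β + β') := by
  simp only [rootSign, qa, qb, qc, qd, OfNat.ofNat_ne_one, if_false, if_true]
  rw [sign_of_ne_zero (pair_ne_zero ha _), sign_of_ne_zero (pair_ne_zero hb _),
    sign_of_ne_zero (pair_ne_zero hc _), sign_of_ne_zero (pair_ne_zero hd _), pair_sub, pair_sub,
    pair_smul]
  push_cast
  split_ifs <;> first | (exfalso; linarith) | ring

/-- Up to sign, this is the derivative of `rootCoth_B2` in a direction ξ with b · ξ = 2v - u and (a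
- b) · ξ = u. In it C_α differentiates to -H_α (α · ξ) for short roots and to half of that for long
ones. -/
theorem rootCsch_B2 {N : ℕ} (β β' : ℝ) {a b : Fin N → ℤ} (ha : a ∈ roots N) (hb : b ∈ roots N)
    (hc : a - b ∈ roots N) (hd : a - (2 : ℤ) • b ∈ roots N) (qa : a ⬝ᵥ a = 2) (qb : b ⬝ᵥ b = 1)
    (qc : (a - b) ⬝ᵥ (a - b) = 1) (qd : (a - (2 : ℤ) • b) ⬝ᵥ (a - (2 : ℤ) • b) = 2)
    (x : RegularPoint N) (u v : ℝ) :
    (rootCsch β β' a x * v * rootCoth β β' (a - b) x +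
        u * rootCoth β β' a x * rootCsch β β' (a - b) x) +
      (rootCsch β β' (a - b) x * u * rootCoth β β' (a - (2 : ℤ) • b) x +
        (u - v) * rootCoth β β' (a - b) x * rootCsch β β' (a - (2 : ℤ) • b) x) +
      (-rootCsch β β' (a - (2 : ℤ) • b) x * (u - v) * rootCoth β β' b x +
        (u - 2 * v) * rootCoth β β' (a - (2 : ℤ) • b) x * rootCsch β β' b x) +
      (-rootCsch β β' b x * (u - 2 * v) * rootCoth β β' a x +
        v * rootCoth β β' b x * rootCsch β β' a x) = 0 := by
  rw [rootCsch_long β β' ha qa, rootCsch_long β β' hd qd]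
  obtain ⟨A, B, hA, hB, hAB, hBA, e1, e2, e3, e4, e5, e6⟩ :=
    exists_B2_param β β' ha hb hc hd qa qb qc qd x
  rw [e1, e2, e3, e4, e5, e6]
  field_simp
  ring

/-! ### Operators attached to the roots -/

/-- The operator `∑_α f_α(x) s_α`. -/
def reflectionSum {N : ℕ} (f : (Fin N → ℤ) → CoeffFun N) : OpAlgebra N :=
  ∑ a ∈ roots N, SkewMonoidAlgebra.single (reflection a) (f a)

/-- The coefficients of `𝒥_i`. -/
def dunklCoeff {N : ℕ} (β β' : ℝ) (i : Fin N) (a : Fin N → ℤ) : CoeffFun N :=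
  fun x => 1 / 2 * (a i : ℝ) * (rootCoth β β' a x + rootSign β β' a)

/-- The coefficients of the operator of which `ℋ^*` is minus the star image. -/
def hamiltonianCoeff {N : ℕ} (β β' : ℝ) (a : Fin N → ℤ) : CoeffFun N :=
  fun x => 1 / 2 * rootCsch β β' a x

/-- The operator of which `ℋ^*` is minus the star image. -/
def hamiltonian (N : ℕ) (β β' : ℝ) : OpAlgebra N := reflectionSum (hamiltonianCoeff β β')

/-- Only roots with a nonzero i-th entry contribute to 𝒥_i. Among ordered pairs of indices these are
the pairs containing i, and symmetry counts each partner of i twice. -/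
theorem sum_sum_ne_of_symm {ι M : Type*} [Fintype ι] [DecidableEq ι] [AddCommMonoid M] (i : ι)
    (Y : ι → ι → M) (hs : ∀ k j, Y k j = Y j k) (h0 : ∀ k j, k ≠ i → j ≠ i → Y k j = 0) :
    ∑ k, ∑ j with j ≠ k, Y k j = ∑ j with j ≠ i, (Y i j + Y i j) := by
  rw [← Finset.add_sum_erase _ _ (Finset.mem_univ i), Finset.sum_add_distrib]
  congr 1
  rw [← Finset.filter_ne']
  refine Finset.sum_congr rfl fun k hk => ?_
  have hki : k ≠ i := (Finset.mem_filter.1 hk).2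
  rw [Finset.sum_eq_single i, hs]
  · exact fun j _ hj => h0 k j hki hj
  · exact fun h => absurd (Finset.mem_filter.2 ⟨Finset.mem_univ i, hki.symm⟩) h

theorem single_sub_single_sq {N : ℕ} {i j : Fin N} (hij : i ≠ j) :
    (Pi.single i 1 - Pi.single j 1 : Fin N → ℤ) ⬝ᵥ (Pi.single i 1 - Pi.single j 1) = 2 := by
  simp [hij, hij.symm]

theorem rootSign_exch {N : ℕ} (β β' : ℝ) {i j : Fin N} (hij : i ≠ j) :
    rootSign β β' (Pi.single i 1 - Pi.single j 1 : Fin N → ℤ) = if j < i then -1 else 1 := by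
  rw [rootSign, single_sub_single_sq hij, if_neg (by norm_num), pair_sub, pair_single, pair_single,
    rho_apply, rho_apply]
  push_cast
  rcases lt_or_gt_of_ne hij with h | h
  · have h1 : ((i : ℕ) : ℝ) < (j : ℕ) := by exact_mod_cast h
    rw [if_neg h.not_gt, Real.sign_of_pos (by linarith)]
  · have h1 : ((j : ℕ) : ℝ) < (i : ℕ) := by exact_mod_cast h
    rw [if_pos h, Real.sign_of_neg (by linarith)]

theorem rho_pos {N : ℕ} (i : Fin N) : 0 < (rho N).1 i := by
  rw [rho_apply, sub_pos]
  exact_mod_cast i.2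

theorem rootSign_exchTilde {N : ℕ} (β β' : ℝ) {i j : Fin N} (hij : i ≠ j) :
    rootSign β β' (Pi.single i 1 + Pi.single j 1 : Fin N → ℤ) = 1 := by
  have h : (Pi.single i 1 + Pi.single j 1 : Fin N → ℤ) ⬝ᵥ (Pi.single i 1 + Pi.single j 1) = 2 :=
    single_add_single_sq hij 1 1
  rw [rootSign, h, if_neg (by norm_num), pair_add, pair_single, pair_single, Int.cast_one, one_mul,
    one_mul]
  exact Real.sign_of_pos (add_pos (rho_pos i) (rho_pos j))

theorem rootSign_flip {N : ℕ} (β β' : ℝ) (i : Fin N) :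
    rootSign β β' (Pi.single i 1 : Fin N → ℤ) = β + β' := by
  rw [rootSign, if_pos (by simp), pair_single, Int.cast_one, one_mul,
    Real.sign_of_pos (rho_pos i), mul_one]

theorem dunklCoeff_neg {N : ℕ} (β β' : ℝ) (i : Fin N) (a : Fin N → ℤ) :
    dunklCoeff β β' i (-a) = dunklCoeff β β' i a := by
  funext x
  simp only [dunklCoeff, rootCoth_neg, rootSign_neg, Pi.neg_apply]
  push_cast
  ring

theorem dunklCoeff_flip {N : ℕ} (β β' : ℝ) (i : Fin N) :
    dunklCoeff β β' i (Pi.single i 1) + dunklCoeff β β' i (Pi.single i 1) =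
      fun x : RegularPoint N => β * (1 + coth (x.1 i)) + β' * (1 + Real.tanh (x.1 i)) := by
  funext x
  simp only [dunklCoeff, rootSign_flip, rootCoth, Pi.add_apply, pair_single]
  rw [if_pos (by simp), Pi.single_eq_same]
  push_cast
  rw [one_mul]
  ring

/-- Here the term -2 ∑_{j<i} K_ij of 𝒥_i finds its place: it replaces 1 + coth by -1 + coth exactly
when e_i - e_j is a negative root. -/
theorem dunklCoeff_exch {N : ℕ} (β β' : ℝ) {i j : Fin N} (hij : i ≠ j) :
    dunklCoeff β β' i (Pi.single i 1 - Pi.single j 1) +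
        dunklCoeff β β' i (Pi.single i 1 - Pi.single j 1) =
      (fun x : RegularPoint N => 1 + coth (x.1 i - x.1 j)) - if j < i then 2 else 0 := by
  funext x
  simp only [dunklCoeff, rootSign_exch β β' hij, rootCoth, Pi.add_apply, pair_sub, pair_single]
  rw [single_sub_single_sq hij, if_neg (by norm_num), Pi.sub_apply, Pi.sub_apply,
    Pi.single_eq_same, Pi.single_eq_of_ne hij]
  push_cast
  split_ifs
  · simp only [one_mul, Pi.ofNat_apply]
    ring
  · simp only [one_mul, Pi.zero_apply]
    ring

theorem dunklCoeff_exchTilde {N : ℕ} (β β' : ℝ) {i j : Fin N} (hij : i ≠ j) :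
    dunklCoeff β β' i (Pi.single i 1 + Pi.single j 1) +
        dunklCoeff β β' i (Pi.single i 1 + Pi.single j 1) =
      fun x : RegularPoint N => 1 + coth (x.1 i + x.1 j) := by
  have h : (Pi.single i 1 + Pi.single j 1 : Fin N → ℤ) ⬝ᵥ (Pi.single i 1 + Pi.single j 1) = 2 :=
    single_add_single_sq hij 1 1
  funext x
  simp only [dunklCoeff, rootSign_exchTilde β β' hij, rootCoth, Pi.add_apply, pair_add,
    pair_single]
  rw [h, if_neg (by norm_num), Pi.single_eq_same, Pi.single_eq_of_ne hij]
  push_cast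
  rw [one_mul, one_mul]
  ring

theorem dunklCoeff_eq_zero {N : ℕ} (β β' : ℝ) {i : Fin N} {a : Fin N → ℤ} (h : a i = 0) :
    dunklCoeff β β' i a = 0 := by
  funext x
  simp [dunklCoeff, h]

theorem calJ_eq {N : ℕ} (β β' : ℝ) (i : Fin N) :
    calJ β β' i = reflectionSum (dunklCoeff β β' i) := by
  have hsymm : ∀ a : Fin N → ℤ,
      SkewMonoidAlgebra.single (reflection (-a)) (dunklCoeff β β' i (-a)) =
        SkewMonoidAlgebra.single (reflection a) (dunklCoeff β β' i a) := fun a => by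
    rw [reflection_neg, dunklCoeff_neg]
  rw [reflectionSum, sum_roots _ hsymm]
  rw [sum_sum_ne_of_symm i, Finset.sum_eq_single i, ← SkewMonoidAlgebra.single_add,
    dunklCoeff_flip, reflection_flip, calJ, Finset.smul_sum]
  · have hlt : ∑ j with j < i, 2 • SkewMonoidAlgebra.single (exch i j) (1 : CoeffFun N) =
        ∑ j with j ≠ i, if j < i then 2 • SkewMonoidAlgebra.single (exch i j) (1 : CoeffFun N)
          else 0 := by
      rw [← Finset.sum_filter, Finset.filter_filter]
      refine Finset.sum_congr (Finset.filter_congr fun j _ => ?_) fun _ _ => rfl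
      exact ⟨fun h => ⟨h.ne, h⟩, fun h => h.2⟩
    rw [hlt, add_sub_right_comm, ← Finset.sum_sub_distrib, add_comm]
    congr 1
    refine Finset.sum_congr rfl fun j hj => ?_
    have hij : i ≠ j := (Finset.mem_filter.1 hj).2.symm
    rw [add_add_add_comm, ← SkewMonoidAlgebra.single_add, ← SkewMonoidAlgebra.single_add,
      dunklCoeff_exch β β' hij, dunklCoeff_exchTilde β β' hij, reflection_exch hij,
      reflection_exchTilde hij, add_sub_right_comm]
    congr 1
    split_ifs
    · rw [two_smul, ← SkewMonoidAlgebra.single_add, one_add_one_eq_two, sub_eq_add_neg,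
        sub_eq_add_neg, SkewMonoidAlgebra.single_add, SkewMonoidAlgebra.single_neg]
    · rw [sub_zero, sub_zero]
  · intro k _ hk
    rw [dunklCoeff_eq_zero β β' (Pi.single_eq_of_ne hk.symm 1), SkewMonoidAlgebra.single_zero_right,
      add_zero]
  · exact fun h => absurd (Finset.mem_univ i) h
  · intro k j
    rw [← hsymm (Pi.single k 1 - Pi.single j 1), neg_sub, add_comm (Pi.single k 1)]
  · intro k j hk hj
    rw [dunklCoeff_eq_zero, dunklCoeff_eq_zero]
    · simp
    · simp [hk.symm, hj.symm]
    · simp [hk.symm, hj.symm]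

/-! ### Commutators as sums over pairs of roots. -/

theorem toOperator_reflectionSum_mul {N : ℕ} (f h : (Fin N → ℤ) → CoeffFun N) (g : CoeffFun N)
    (x : RegularPoint N) :
    toOperator N (reflectionSum f * reflectionSum h) g x =
      ∑ p ∈ roots N ×ˢ roots N, g ((reflection p.1 * reflection p.2)⁻¹ • x) *
        (f p.1 x * h p.2 ((reflection p.1)⁻¹ • x)) := by
  rw [reflectionSum, reflectionSum, Finset.sum_mul_sum, ← Finset.sum_product', map_sum,
    LinearMap.sum_apply, Finset.sum_apply]
  refine Finset.sum_congr rfl fun p _ => ?_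
  rw [SkewMonoidAlgebra.single_mul_single, toOperator_single, Pi.mul_apply, weyl_smul_apply]
  ring

theorem rootCoth_inv_reflection_smul {N : ℕ} (β β' : ℝ) (p : (Fin N → ℤ) × (Fin N → ℤ))
    (x : RegularPoint N) :
    rootCoth β β' p.2 ((reflection p.1)⁻¹ • x) = -rootCoth β β' (rotate p).1 x := by
  rw [rootCoth_inv_smul, rotate, rootCoth_neg, neg_neg]

theorem rootCsch_inv_reflection_smul {N : ℕ} (β β' : ℝ) (p : (Fin N → ℤ) × (Fin N → ℤ))
    (x : RegularPoint N) :
    rootCsch β β' p.2 ((reflection p.1)⁻¹ • x) = rootCsch β β' (rotate p).1 x := by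
  rw [rootCsch_inv_smul, rotate, rootCsch_neg]

theorem apply_reflection_rotate {N : ℕ} (g : CoeffFun N) (x : RegularPoint N) :
    ∀ p ∈ roots N ×ˢ roots N,
      g ((reflection (rotate p).1 * reflection (rotate p).2)⁻¹ • x) =
        g ((reflection p.1 * reflection p.2)⁻¹ • x) := fun p hp => by
  rw [reflection_rotate (Finset.mem_product.1 hp).2]

/-- Along an orbit of `rotate` the factor α_i β_j - α_j β_i is constant. In (C_α + K_α)(K_β - C_γ),
with γ = -s_α β, the mixed terms C K telescope. There remain a sum of C C terms and one of K K terms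
with opposite signs, and both have the same constant value by the A₂ and B₂ relations. -/
theorem commute_calJ {N : ℕ} (β β' : ℝ) (i j : Fin N) :
    Commute (calJ β β' i) (calJ β β' j) := by
  rw [calJ_eq, calJ_eq]
  refine toOperator_injective N (LinearMap.ext fun g => funext fun x => ?_)
  rw [toOperator_reflectionSum_mul, toOperator_reflectionSum_mul, ← sub_eq_zero,
    ← Finset.sum_sub_distrib]
  set C : (Fin N → ℤ) → ℝ := fun a => rootCoth β β' a x with hC
  set K : (Fin N → ℤ) → ℝ := rootSign β β' with hK
  set F : (Fin N → ℤ) → (Fin N → ℤ) → (Fin N → ℤ) → ℝ := fun c a b =>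
    1 / 4 * ((a i : ℝ) * b j - a j * b i) * ((C a + K a) * (K b - C c)) with hF
  have hCn : ∀ a, C (-a) = -C a := fun a => rootCoth_neg β β' a x
  have hKn : ∀ a, K (-a) = -K a := rootSign_neg β β'
  have hsum := sum_pairs_eq_zero (fun p => g ((reflection p.1 * reflection p.2)⁻¹ • x))
    (apply_reflection_rotate g x) F
    (fun a ha b hb c hc => by simp only [hF, hCn, hKn, Pi.neg_apply]; push_cast; ring)
    (fun a ha b hb c hc => by simp only [hF, hCn, hKn, Pi.neg_apply]; push_cast; ring)
    (fun a ha b hb h => by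
      simp only [hF, hCn, hKn, Pi.neg_apply]; push_cast; ring)
    (fun a ha b hb hc qa qb qc => by
      have h1 := rootCoth_A2 β β' ha hb hc qa qb qc x
      have h2 := rootSign_A2 β β' ha hb hc qa qb qc
      simp only [hF, hCn, hKn, Pi.neg_apply, Pi.sub_apply]
      push_cast
      linear_combination (1 / 4 * ((a i : ℝ) * b j - a j * b i)) * (h1 - h2))
    (fun a ha b hb hc hd qa qb qc qd => by
      have h1 := rootCoth_B2 β β' ha hb hc hd qa qb qc qd x
      have h2 := rootSign_B2 β β' ha hb hc hd qa qb qc qd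
      simp only [hF, hCn, hKn, Pi.neg_apply, Pi.sub_apply, Pi.smul_apply,
        smul_eq_mul]
      push_cast
      linear_combination (1 / 4 * ((a i : ℝ) * b j - a j * b i)) * (h2 - h1))
  rw [← hsum, Finset.sum_filter]
  refine Finset.sum_congr rfl fun p hp => ?_
  obtain ⟨ha, hb⟩ := Finset.mem_product.1 hp
  have hval : ∀ k l : Fin N, dunklCoeff β β' k p.1 x *
      dunklCoeff β β' l p.2 ((reflection p.1)⁻¹ • x) =
        1 / 4 * ((p.1 k : ℝ) * p.2 l) * ((C p.1 + K p.1) * (K p.2 - C (rotate p).1)) := by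
    intro k l
    simp only [dunklCoeff, rootCoth_inv_reflection_smul, hC, hK]
    ring
  rw [hval, hval]
  split_ifs with hlt
  · simp only [hF]
    ring
  -- For β = ±α the factor α_i β_j - α_j β_i vanishes.
  · rcases (sq_dotProduct_lt_or ha hb).resolve_left hlt with h | h
    · rw [h]
      ring
    · rw [h]
      simp only [Pi.neg_apply]
      push_cast
      ring

/-- The partial derivative of the potential at a regular point. -/
def potentialDeriv {N : ℕ} (β β' : ℝ) (i : Fin N) : CoeffFun N :=
  fun x => -∑ a ∈ roots N, (a i : ℝ) * (rootCsch β β' a x * rootCoth β β' a x)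

/-- The terms containing K telescope along every orbit, and the others cancel in each plane by the
A₂ and B₂ identities. Only the pairs β = ±α survive; their group element is s_α s_α = 1, so a
multiplication operator remains. -/
theorem hamiltonian_mul_calJ_sub {N : ℕ} (β β' : ℝ) (i : Fin N) :
    hamiltonian N β β' * calJ β β' i - calJ β β' i * hamiltonian N β β' =
      SkewMonoidAlgebra.single 1 (potentialDeriv β β' i) := by
  rw [calJ_eq, hamiltonian]
  refine toOperator_injective N (LinearMap.ext fun g => funext fun x => ?_)
  rw [map_sub, LinearMap.sub_apply, Pi.sub_apply, toOperator_reflectionSum_mul,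
    toOperator_reflectionSum_mul, ← Finset.sum_sub_distrib, toOperator_single, inv_one, one_smul]
  set C : (Fin N → ℤ) → ℝ := fun a => rootCoth β β' a x with hC
  set H : (Fin N → ℤ) → ℝ := fun a => rootCsch β β' a x with hH
  set K : (Fin N → ℤ) → ℝ := rootSign β β' with hK
  set F : (Fin N → ℤ) → (Fin N → ℤ) → (Fin N → ℤ) → ℝ := fun c a b =>
    1 / 4 * (H a * b i * (K b - C c) - a i * (C a + K a) * H c) with hF
  have hCn : ∀ a, C (-a) = -C a := fun a => rootCoth_neg β β' a x
  have hHn : ∀ a, H (-a) = H a := fun a => rootCsch_neg β β' a x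
  have hKn : ∀ a, K (-a) = -K a := rootSign_neg β β'
  have hsum := sum_pairs_eq_zero (fun p => g ((reflection p.1 * reflection p.2)⁻¹ • x))
    (apply_reflection_rotate g x) F
    (fun a ha b hb c hc => by simp only [hF, hCn, hHn, hKn, Pi.neg_apply]; push_cast; ring)
    (fun a ha b hb c hc => by simp only [hF, hCn, hHn, hKn, Pi.neg_apply]; push_cast; ring)
    (fun a ha b hb h => by
      simp only [hF, hCn, hHn, hKn, Pi.neg_apply]; push_cast; ring)
    (fun a ha b hb hc qa qb qc => by
      have h1 := rootCoth_A2 β β' ha hb hc qa qb qc x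
      have e1 : H a = 2 * (C a ^ 2 - 1) := rootCsch_long β β' ha qa x
      have e2 : H b = 2 * (C b ^ 2 - 1) := rootCsch_long β β' hb qb x
      have e3 : H (a - b) = 2 * (C (a - b) ^ 2 - 1) := rootCsch_long β β' hc qc x
      change C (a - b) * (C b - C a) = C a * C b - 1 at h1
      simp only [hF, hCn, hHn, hKn, Pi.neg_apply, Pi.sub_apply, e1, e2, e3]
      push_cast
      linear_combination (1 / 2 * ((a i : ℝ) * (C (a - b) - C b) + b i * (C a + C b))) * h1)
    (fun a ha b hb hc hd qa qb qc qd => by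
      have h1 : _ = (0 : ℝ) := rootCsch_B2 β β' ha hb hc hd qa qb qc qd x (a i) (b i)
      simp only [hF, hCn, hHn, hKn, Pi.neg_apply, Pi.sub_apply, Pi.smul_apply,
        smul_eq_mul]
      push_cast
      linear_combination (-1 / 4) * h1)
  have hdiag : ∑ p ∈ roots N ×ˢ roots N with
      ¬ (p.1 ⬝ᵥ p.2) ^ 2 < (p.1 ⬝ᵥ p.1) * (p.2 ⬝ᵥ p.2),
        g ((reflection p.1 * reflection p.2)⁻¹ • x) * F (rotate p).1 p.1 p.2 =
      potentialDeriv β β' i x * g x := by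
    rw [Finset.sum_filter, Finset.sum_product, potentialDeriv, ← Finset.sum_neg_distrib,
      Finset.sum_mul]
    refine Finset.sum_congr rfl fun a ha => ?_
    have hna : a ≠ -a := fun h => by
      have h1 : a ⬝ᵥ a = -(a ⬝ᵥ a) := by
        conv_lhs => rw [h, neg_dotProduct]
        rw [← h]
      rcases mem_roots.1 ha with h2 | h2 <;> omega
    have hset : ({b ∈ roots N | ¬ (a ⬝ᵥ b) ^ 2 < (a ⬝ᵥ a) * (b ⬝ᵥ b)} : Finset _) = {a, -a} := by
      ext b
      simp only [Finset.mem_filter, Finset.mem_insert, Finset.mem_singleton]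
      constructor
      · rintro ⟨hb, hlt⟩
        exact (sq_dotProduct_lt_or ha hb).resolve_left hlt
      · rintro (rfl | rfl)
        · exact ⟨ha, by rw [sq]; exact lt_irrefl _⟩
        · refine ⟨neg_mem_roots.2 ha, ?_⟩
          rw [dotProduct_neg, dotProduct_neg, neg_dotProduct, neg_neg, neg_sq, sq]
          exact lt_irrefl _
    rw [← Finset.sum_filter, hset, Finset.sum_pair hna]
    -- A pair (a, a) is fixed by `rotate`, so F a a a = -½ a_i H_a C_a. The pair (a, -a) contributes
    -- the same amount.
    have e1 : rotate (a, a) = (a, a) := by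
      rw [rotate_eq ha, coef_mul_sq ha, two_smul, add_sub_cancel_right]
    simp only [rotate_neg_right, e1, reflection_neg, reflection_mul_self ha, inv_one, one_smul, hF,
      hCn, hHn, hKn, Pi.neg_apply]
    push_cast
    ring
  rw [← hdiag, ← zero_add (∑ p ∈ _ with ¬ _, _), ← hsum, Finset.sum_filter_add_sum_filter_not]
  refine Finset.sum_congr rfl fun p _ => ?_
  simp only [dunklCoeff, hamiltonianCoeff, rootCoth_inv_reflection_smul,
    rootCsch_inv_reflection_smul, hF, hC, hH, hK]
  ring

/-! ### Hecke relations -/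

/-- A simple reflection preserves the sign of the roots different from `±σ`. -/
theorem rootSign_act_reflection {N : ℕ} (β β' : ℝ) {σ b : Fin N → ℤ} (hσ : σ ∈ roots N)
    (hs : pair σ (rho N).1 = 1) (hb : b ∈ roots N) (h1 : b ≠ σ) (h2 : b ≠ -σ) :
    rootSign β β' (act (reflection σ) b) = rootSign β β' b := by
  have hint : ∀ a : Fin N → ℤ, ∃ z : ℤ, pair a (rho N).1 = z := fun a =>
    ⟨∑ k, a k * ((N : ℤ) - (k : ℕ)), by simp only [pair, rho_apply]; push_cast; rfl⟩
  have hlt := (sq_dotProduct_lt_or hσ hb).resolve_right (not_or.2 ⟨h1, h2⟩)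
  obtain ⟨z, hz⟩ := hint b
  have hz0 : z ≠ 0 := by
    have := pair_ne_zero hb (rho N)
    rw [hz] at this
    exact_mod_cast this
  have hp : pair (act (reflection σ) b) (rho N).1 = ((z - coef σ * (σ ⬝ᵥ b) : ℤ) : ℝ) := by
    rw [act_reflection hσ, pair_sub, pair_smul, hs, hz]
    push_cast
    ring
  have hz1 : z - coef σ * (σ ⬝ᵥ b) ≠ 0 := by
    have := pair_ne_zero ((act_mem_roots (reflection σ)).2 hb) (rho N)
    rw [hp] at this
    exact_mod_cast this
  have key : 0 < z - coef σ * (σ ⬝ᵥ b) ↔ 0 < z := by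
    -- Let z be the value of b at `rho`; `s_σ` moves it by an integer of absolute value at most 2,
    -- keeping it nonzero. A jump by 2 over zero would need a short σ and a long b, but then b - (σ
    -- · b) σ is a root with the intermediate value, which cannot be 0 either.
    rcases mem_roots.1 hσ with q | q
    · rw [coef_eq_two q] at hz1 ⊢
      rw [q, one_mul] at hlt
      have hu : σ ⬝ᵥ b = 0 ∨ ((σ ⬝ᵥ b = 1 ∨ σ ⬝ᵥ b = -1) ∧ b ⬝ᵥ b = 2) := by
        rcases mem_roots.1 hb with qb | qb <;> rw [qb] at hlt
        · left
          have : σ ⬝ᵥ b < 1 := by nlinarith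
          have : -1 < σ ⬝ᵥ b := by nlinarith
          omega
        · have : σ ⬝ᵥ b < 2 := by nlinarith
          have : -2 < σ ⬝ᵥ b := by nlinarith
          omega
      rcases hu with hu | ⟨hu, qb⟩
      · rw [hu]
        omega
      · have hr : b - (σ ⬝ᵥ b) • σ ∈ roots N := by
          refine mem_roots.2 (Or.inl ?_)
          rw [sq_sub_smul, dotProduct_comm b σ, qb, q]
          rcases hu with hu | hu <;> rw [hu] <;> norm_num
        have hr' := pair_ne_zero hr (rho N)
        rw [pair_sub, pair_smul, hs, hz, mul_one] at hr'
        have hz2 : z - σ ⬝ᵥ b ≠ 0 := by exact_mod_cast hr'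
        rcases hu with hu | hu <;> rw [hu] at hz1 hz2 ⊢ <;> omega
    · rw [coef_eq_one q, one_mul] at hz1 ⊢
      have h4 : (σ ⬝ᵥ b) ^ 2 < 4 := by
        rcases mem_roots.1 hb with qb | qb <;> rw [q, qb] at hlt <;> linarith
      have : σ ⬝ᵥ b < 2 := by nlinarith
      have : -2 < σ ⬝ᵥ b := by nlinarith
      omega
  have hsign : Real.sign (pair (act (reflection σ) b) (rho N).1) =
      Real.sign (pair b (rho N).1) := by
    rw [hp, hz, sign_of_ne_zero (by exact_mod_cast hz1), sign_of_ne_zero (by exact_mod_cast hz0)]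
    simp only [Int.cast_pos, key]
  simp only [rootSign, act_dotProduct, hsign]

/-- Conjugation by s_σ permutes the roots and carries C_α along, but K_α refers to a fixed chamber.
The defect is thus a sum of differences K_{s_σ b} - K_b, which vanish unless b = ±σ. These two terms
have group element s_σ s_σ = 1 and give the constant. -/
theorem hecke_relation {N : ℕ} (β β' : ℝ) {σ : Fin N → ℤ} (hσ : σ ∈ roots N)
    (hs : pair σ (rho N).1 = 1) {i j : Fin N} {ε : ℤ}
    (hij : ∀ b : Fin N → ℤ, act (reflection σ) b i = ε * b j) :
    SkewMonoidAlgebra.single (reflection σ) 1 * calJ β β' i =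
      (ε : OpAlgebra N) * (calJ β β' j * SkewMonoidAlgebra.single (reflection σ) 1) +
        SkewMonoidAlgebra.single 1 (fun _ => -2 * ε * σ j * rootSign β β' σ) := by
  set s := reflection σ with hsdef
  have hss : s⁻¹ = s := reflection_inv hσ
  have hssm : s * s = 1 := reflection_mul_self hσ
  -- The defect of the root b, after reindexing the left-hand sum by s_σ.
  set R : (Fin N → ℤ) → OpAlgebra N := fun b =>
    SkewMonoidAlgebra.single (reflection b * s)
      (fun _ => 1 / 2 * ε * b j * (rootSign β β' (act s b) - rootSign β β' b)) with hR
  have hRsum : ∑ b ∈ roots N, R b =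
      SkewMonoidAlgebra.single 1 (fun _ => -2 * ε * σ j * rootSign β β' σ) := by
    have hsub : ({σ, -σ} : Finset (Fin N → ℤ)) ⊆ roots N := by
      intro b hb
      rcases Finset.mem_insert.1 hb with rfl | hb
      · exact hσ
      · rw [Finset.mem_singleton.1 hb]
        exact neg_mem_roots.2 hσ
    have hne : σ ≠ -σ := fun h => by
      have h1 := congrArg (fun a => pair a (rho N).1) h
      simp only [pair_neg, hs] at h1
      norm_num at h1
    have hsσ : act s σ = -σ := by
      rw [act_reflection hσ, coef_mul_sq hσ, two_smul]
      abel
    rw [← Finset.sum_subset hsub, Finset.sum_pair hne]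
    · simp only [hR, reflection_neg, act_neg, rootSign_neg, hsσ, neg_neg]
      rw [← hsdef, hssm, ← SkewMonoidAlgebra.single_add]
      congr 1
      funext x
      simp only [Pi.add_apply, Pi.neg_apply]
      push_cast
      ring
    · intro b hb hb'
      simp only [Finset.mem_insert, Finset.mem_singleton, not_or] at hb'
      simp only [hR, hsdef, rootSign_act_reflection β β' hσ hs hb hb'.1 hb'.2, sub_self, mul_zero]
      exact SkewMonoidAlgebra.single_zero_right _
  rw [← hRsum, calJ_eq, calJ_eq, reflectionSum, reflectionSum, Finset.mul_sum, Finset.sum_mul,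
    Finset.mul_sum, ← Finset.sum_add_distrib, ← sum_roots_act s]
  refine Finset.sum_congr rfl fun b hb => ?_
  have h1 : s * reflection (act s b) = reflection b * s := by
    rw [mul_reflection s ((act_mem_roots s).2 hb), ← act_mul, hssm, act_one]
  rw [SkewMonoidAlgebra.single_mul_single, SkewMonoidAlgebra.single_mul_single, h1,
    SkewMonoidAlgebra.intCast_def, SkewMonoidAlgebra.single_mul_single,
    one_mul (reflection b * s)]
  simp only [hR]
  rw [← SkewMonoidAlgebra.single_add]
  congr 1
  funext x
  simp only [one_smul, smul_one, mul_one, weyl_smul_apply, dunklCoeff, Pi.add_apply, Pi.one_apply,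
    Pi.mul_apply, Pi.intCast_apply, rootCoth_inv_smul, hij]
  rw [← act_mul, hssm, act_one]
  push_cast
  ring

/-! ### Weyl invariance of the even power sums of the 𝒥_i. -/

theorem commute_single_one_const {N : ℕ} (r : ℝ) (A : OpAlgebra N) :
    Commute (SkewMonoidAlgebra.single 1 (fun _ => r) : OpAlgebra N) A := by
  induction A using SkewMonoidAlgebra.induction_on with
  | zero => exact Commute.zero_right _
  | single w f =>
    rw [Commute, SemiconjBy, SkewMonoidAlgebra.single_mul_single,
      SkewMonoidAlgebra.single_mul_single, one_mul, mul_one, one_smul, mul_comm]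
    rfl
  | add f g hf hg => exact hf.add_right hg

/-- By induction s a^n = b^n s + c h and s b^n = a^n s - c h with the same h, the divided difference
(a^n - b^n)/(a - b). The corrections cancel in the sum. -/
theorem commute_pow_add_pow {R : Type*} [Ring R] {s a b c : R} (hab : Commute a b)
    (hca : Commute c a) (hcb : Commute c b) (h1 : s * a = b * s + c) (h2 : s * b = a * s - c)
    (n : ℕ) : Commute s (a ^ n + b ^ n) := by
  have key : ∃ h : R, s * a ^ n = b ^ n * s + c * h ∧ s * b ^ n = a ^ n * s - c * h ∧
      h * (a - b) = a ^ n - b ^ n := by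
    induction n with
    | zero => exact ⟨0, by simp, by simp, by simp⟩
    | succ n ih =>
      obtain ⟨h, e1, e2, e3⟩ := ih
      -- The recursion for divided differences; since h (a - b) = a^n - b^n, the witness also equals
      -- a^n + h b, the form needed for the second relation.
      refine ⟨b ^ n + h * a, ?_, ?_, ?_⟩
      · rw [pow_succ, ← mul_assoc, e1, add_mul, mul_assoc, h1, mul_add, pow_succ,
          ← (hcb.pow_right n).eq]
        noncomm_ring
      · have e4 : b ^ n + h * a = a ^ n + h * b := by
          rw [mul_sub, sub_eq_sub_iff_add_eq_add] at e3
          rw [add_comm, e3]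
          
        rw [pow_succ, ← mul_assoc, e2, sub_mul, mul_assoc, h2, mul_sub, e4, pow_succ,
          ← (hca.pow_right n).eq]
        noncomm_ring
      · have e4 : h * a * (a - b) = (a ^ n - b ^ n) * a := by
          rw [← e3, mul_assoc, mul_assoc, mul_sub, sub_mul, hab.eq]
        rw [add_mul, e4, mul_sub, sub_mul, pow_succ, pow_succ]
        abel
  obtain ⟨h, e1, e2, -⟩ := key
  rw [Commute, SemiconjBy, mul_add, add_mul, e1, e2]
  abel

/-- Passing s through a twice restores the sign, and the corrections c a and -a c cancel. This is
where the evenness of the exponent 2p enters. -/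
theorem commute_sq_of_anticommute {R : Type*} [Ring R] {s a c : R} (hca : Commute c a)
    (h : s * a = ((-1 : ℤ) : R) * (a * s) + c) : Commute s (a ^ 2) := by
  rw [Int.cast_neg, Int.cast_one, neg_one_mul] at h
  rw [Commute, SemiconjBy, sq, ← mul_assoc, h, add_mul, neg_mul, mul_assoc, h, hca.eq]
  noncomm_ring

theorem pair_rho_exch {m : ℕ} (k : Fin m) :
    pair (Pi.single k.castSucc 1 - Pi.single k.succ 1 : Fin (m + 1) → ℤ) (rho (m + 1)).1 = 1 := by
  rw [pair_sub, pair_single, pair_single, rho_apply, rho_apply]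
  simp only [Fin.val_castSucc, Fin.val_succ]
  push_cast
  ring

theorem pair_rho_flip {m : ℕ} :
    pair (Pi.single (Fin.last m) 1 : Fin (m + 1) → ℤ) (rho (m + 1)).1 = 1 := by
  rw [pair_single, rho_apply]
  simp

theorem commute_exch_calI {m : ℕ} (β β' : ℝ) (p : ℕ) (k : Fin m) :
    Commute (SkewMonoidAlgebra.single (exch k.castSucc k.succ) 1) (calI β β' p) := by
  set i := k.castSucc with hi
  set j := k.succ with hj
  have hij : i ≠ j := (Fin.castSucc_lt_succ (i := k)).ne
  have hσ : (Pi.single i 1 - Pi.single j 1 : Fin (m + 1) → ℤ) ∈ roots (m + 1) :=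
    mem_roots.2 (Or.inr (single_sub_single_sq hij))
  have hsign : rootSign β β' (Pi.single i 1 - Pi.single j 1 : Fin (m + 1) → ℤ) = 1 := by
    rw [rootSign_exch β β' hij, if_neg (Fin.castSucc_lt_succ (i := k)).not_gt]
  have hecke : ∀ l, SkewMonoidAlgebra.single (exch i j) 1 * calJ β β' l =
      calJ β β' (Equiv.swap i j l) * SkewMonoidAlgebra.single (exch i j) 1 +
        SkewMonoidAlgebra.single 1 (fun _ =>
          -2 * (((Pi.single i 1 - Pi.single j 1 : Fin (m + 1) → ℤ) (Equiv.swap i j l) : ℤ) : ℝ)) := by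
    intro l
    have h := hecke_relation β β' hσ (pair_rho_exch k) (i := l) (j := Equiv.swap i j l) (ε := 1)
      (fun b => by rw [reflection_exch hij, act_exch, one_mul])
    rw [reflection_exch hij, hsign, Int.cast_one, one_mul] at h
    simpa only [Int.cast_one, mul_one] using h
  have hi' := hecke i
  have hj' := hecke j
  rw [Equiv.swap_apply_left] at hi'
  rw [Equiv.swap_apply_right] at hj'
  simp only [Pi.sub_apply, Pi.single_eq_same, Pi.single_eq_of_ne hij, Pi.single_eq_of_ne hij.symm]
    at hi' hj'
  rw [calI, ← Finset.add_sum_erase _ _ (Finset.mem_univ i),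
    ← Finset.add_sum_erase _ _ (Finset.mem_erase.2 ⟨hij.symm, Finset.mem_univ j⟩), ← add_assoc]
  refine Commute.add_right ?_ (Commute.sum_right _ _ _ fun l hl => Commute.pow_right ?_ _)
  · refine commute_pow_add_pow (commute_calJ β β' i j) (commute_single_one_const _ _)
      (commute_single_one_const _ _) hi' ?_ _
    rw [hj', eq_sub_iff_add_eq, add_assoc, ← SkewMonoidAlgebra.single_add]
    -- The constants in the relations for i and j are opposite, because the simple root e_i - e_j
    -- has opposite entries there.
    have h0 : (fun _ => -2 * ((1 - 0 : ℤ) : ℝ) : CoeffFun (m + 1)) +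
        (fun _ => -2 * ((0 - 1 : ℤ) : ℝ)) = 0 := by
      funext x
      simp
    rw [h0, SkewMonoidAlgebra.single_zero_right, add_zero]
  · obtain ⟨h1, h2, -⟩ := by simpa only [Finset.mem_erase] using hl
    have h := hecke l
    rw [Equiv.swap_apply_of_ne_of_ne h2 h1] at h
    simp only [Pi.sub_apply, Pi.single_eq_of_ne h2, Pi.single_eq_of_ne h1, sub_zero, Int.cast_zero,
      mul_zero] at h
    rw [Commute, SemiconjBy, h]
    exact (congrArg _ (SkewMonoidAlgebra.single_zero_right _)).trans (add_zero _)

theorem commute_flip_last_calI {m : ℕ} (β β' : ℝ) (p : ℕ) :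
    Commute (SkewMonoidAlgebra.single (flip (Fin.last m)) 1) (calI β β' p) := by
  have hecke : ∀ l, ∀ ε : ℤ,
      (∀ b : Fin (m + 1) → ℤ, act (flip (Fin.last m)) b l = ε * b l) →
      ∃ r : ℝ, SkewMonoidAlgebra.single (flip (Fin.last m)) 1 * calJ β β' l =
        (ε : OpAlgebra (m + 1)) * (calJ β β' l * SkewMonoidAlgebra.single (flip (Fin.last m)) 1) +
          SkewMonoidAlgebra.single 1 (fun _ => (if l = Fin.last m then 1 else 0) * r) := by
    intro l ε hε
    have h := hecke_relation β β' (single_mem_roots (Fin.last m) 1) pair_rho_flip (i := l) (j := l)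
      (ε := ε) (fun b => by rw [← hε b, Units.val_one, reflection_flip])
    refine ⟨-2 * ε * (β + β'), ?_⟩
    rw [Units.val_one, reflection_flip, rootSign_flip] at h
    rw [h]
    congr 2
    funext x
    rw [Pi.single_apply]
    push_cast
    ring
  refine Commute.sum_right _ _ _ fun l _ => ?_
  by_cases hl : l = Fin.last m
  · subst hl
    obtain ⟨r, hr⟩ := hecke (Fin.last m) (-1) (fun b => by
      rw [act_flip, Function.update_self, neg_one_mul])
    rw [pow_mul]
    refine Commute.pow_right (commute_sq_of_anticommute (commute_single_one_const _ _)
      hr) _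
  · obtain ⟨r, hr⟩ := hecke l 1 (fun b => by
      rw [act_flip, Function.update_of_ne hl, one_mul])
    refine Commute.pow_right ?_ _
    rw [if_neg hl, zero_mul, Int.cast_one, one_mul] at hr
    rw [Commute, SemiconjBy, hr]
    exact (congrArg _ (SkewMonoidAlgebra.single_zero_right _)).trans (add_zero _)

/-- The Weyl group elements commuting with an operator. -/
def weylCentralizer {N : ℕ} (A : OpAlgebra N) : Submonoid (WeylGroup N) where
  carrier := {w | Commute (SkewMonoidAlgebra.single w 1) A}
  one_mem' := Commute.one_left A
  mul_mem' {v w} hv hw := by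
    have h : (SkewMonoidAlgebra.single (v * w) 1 : OpAlgebra N) =
        SkewMonoidAlgebra.single v 1 * SkewMonoidAlgebra.single w 1 := by
      rw [SkewMonoidAlgebra.single_mul_single, smul_one, mul_one]
    change Commute _ A
    rw [h]
    exact Commute.mul_left hv hw

/-- The elements commuting with ℐ_p form a monoid containing the simple reflections. Adjacent
exchanges generate all exchanges, these conjugate the last sign reversal into every other one, and
each reflection is a product of exchanges and sign reversals. -/
theorem commute_reflection_calI {N : ℕ} (β β' : ℝ) (p : ℕ) {a : Fin N → ℤ} (ha : a ∈ roots N) :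
    Commute (SkewMonoidAlgebra.single (reflection a) 1) (calI β β' p) := by
  obtain _ | m := N
  · rw [calI, Finset.univ_eq_empty, Finset.sum_empty]
    exact Commute.zero_right _
  have hexch : ∀ i j : Fin (m + 1), exch i j ∈ weylCentralizer (calI (N := m + 1) β β' p) := by
    have hle : Submonoid.closure (Set.range fun i : Fin m => Equiv.swap i.castSucc i.succ) ≤
        (weylCentralizer (calI (N := m + 1) β β' p)).comap SemidirectProduct.inr := by
      rw [Submonoid.closure_le]
      rintro _ ⟨k, rfl⟩
      exact commute_exch_calI β β' p k
    rw [Equiv.Perm.mclosure_swap_castSucc_succ] at hle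
    exact fun i j => hle (Submonoid.mem_top (Equiv.swap i j))
  have hflip : ∀ i : Fin (m + 1), flip i ∈ weylCentralizer (calI (N := m + 1) β β' p) := by
    intro i
    have h1 := mul_reflection (exch i (Fin.last m)) (single_mem_roots (Fin.last m) 1)
    have h2 : act (exch i (Fin.last m)) (Pi.single (Fin.last m) 1 : Fin (m + 1) → ℤ) =
        Pi.single i 1 := by
      rw [act_exch]
      funext k
      simp only [Pi.single_apply, Equiv.swap_apply_eq_iff, Equiv.swap_apply_right]
    rw [Units.val_one, h2, reflection_flip, reflection_flip] at h1
    have h3 : flip i = exch i (Fin.last m) * flip (Fin.last m) * (exch i (Fin.last m))⁻¹ :=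
      eq_mul_inv_of_mul_eq h1.symm
    rw [h3, exch_inv]
    exact mul_mem (mul_mem (hexch _ _) (commute_flip_last_calI β β' p)) (hexch _ _)
  change reflection a ∈ weylCentralizer (calI (N := m + 1) β β' p)
  rcases mem_roots.1 ha with h | h
  · obtain ⟨i, ε, rfl⟩ := exists_of_sq_eq_one h
    rw [eq_reflection ha (act_flip_eq i ε)]
    exact hflip i
  · obtain ⟨i, j, ε, δ, hij, rfl⟩ := exists_of_sq_eq_two h
    obtain rfl | rfl : δ = ε ∨ δ = -ε := by
      rcases Int.units_eq_one_or ε with rfl | rfl <;>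
        rcases Int.units_eq_one_or δ with rfl | rfl <;> simp
    · rw [eq_reflection ha (act_exchTilde_eq hij δ), exchTilde]
      exact mul_mem (mul_mem (hflip _) (hflip _)) (hexch _ _)
    · rw [eq_reflection ha (act_exch_eq hij ε)]
      exact hexch _ _

theorem commute_hamiltonian {N : ℕ} (β β' : ℝ) (w : WeylGroup N) :
    Commute (SkewMonoidAlgebra.single w 1) (hamiltonian N β β') := by
  rw [Commute, SemiconjBy, hamiltonian, reflectionSum, Finset.mul_sum, Finset.sum_mul]
  refine Eq.trans (Finset.sum_congr rfl fun a ha => ?_) (sum_roots_act w fun a =>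
    SkewMonoidAlgebra.single (reflection a) (hamiltonianCoeff β β' a) *
      SkewMonoidAlgebra.single w 1)
  rw [SkewMonoidAlgebra.single_mul_single, SkewMonoidAlgebra.single_mul_single, smul_one, mul_one,
    one_mul, mul_reflection w ha]
  congr 1
  funext x
  rw [weyl_smul_apply, hamiltonianCoeff, rootCsch_inv_smul, hamiltonianCoeff]

/-! ### The gradient of the potential -/

theorem hasDerivAt_csch2 {t : ℝ} (ht : t ≠ 0) : HasDerivAt csch2 (-2 * csch2 t * coth t) t := by
  have h := Real.sinh_ne_zero.2 ht
  have h1 := ((Real.hasDerivAt_sinh t).pow 2).fun_inv (pow_ne_zero 2 h)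
  refine (h1.congr_deriv ?_).congr_of_eventuallyEq (Filter.Eventually.of_forall fun s => ?_)
  · simp only [csch2, coth, Pi.pow_apply]
    field_simp
    norm_num
    ring
  · simp [csch2]

theorem hasDerivAt_sech2 (t : ℝ) : HasDerivAt sech2 (-2 * sech2 t * Real.tanh t) t := by
  have h := (Real.cosh_pos t).ne'
  have h1 := ((Real.hasDerivAt_cosh t).pow 2).fun_inv (pow_ne_zero 2 h)
  refine (h1.congr_deriv ?_).congr_of_eventuallyEq (Filter.Eventually.of_forall fun s => ?_)
  · simp only [sech2, Real.tanh_eq_sinh_div_cosh, Pi.pow_apply]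
    field_simp
    norm_num
    ring
  · simp [sech2]

/-- The contribution of a root to the potential, as a function of `α · x`. -/
def potentialProfile {N : ℕ} (β β' : ℝ) (a : Fin N → ℤ) (t : ℝ) : ℝ :=
  if a ⬝ᵥ a = 1 then 1 / 2 * (β ^ 2 * csch2 t - β' ^ 2 * sech2 t) else csch2 t

theorem potential_eq {N : ℕ} (β β' : ℝ) (y : Fin N → ℝ) :
    potential β β' y = ∑ a ∈ roots N, potentialProfile β β' a (pair a y) := by
  rw [sum_roots (fun a => potentialProfile β β' a (pair a y))
    (fun a => by simp [potentialProfile, pair_neg, csch2_neg, sech2_neg]), potential, add_comm]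
  congr 1
  · refine Finset.sum_congr rfl fun i _ => ?_
    simp only [potentialProfile, pair_single]
    rw [if_pos (by simp), Int.cast_one, one_mul]
    ring
  · refine Finset.sum_congr rfl fun i _ => Finset.sum_congr rfl fun j hj => ?_
    have hij : i ≠ j := (Finset.mem_filter.1 hj).2.symm
    have h : (Pi.single i 1 + Pi.single j 1 : Fin N → ℤ) ⬝ᵥ (Pi.single i 1 + Pi.single j 1) = 2 :=
      single_add_single_sq hij 1 1
    simp only [potentialProfile, pair_add, pair_sub, pair_single]
    rw [single_sub_single_sq hij, h, if_neg (by norm_num), if_neg (by norm_num), Int.cast_one,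
      one_mul, one_mul]

theorem hasDerivAt_potentialProfile {N : ℕ} (β β' : ℝ) {a : Fin N → ℤ} (ha : a ∈ roots N)
    (x : RegularPoint N) :
    HasDerivAt (potentialProfile β β' a) (-(rootCsch β β' a x * rootCoth β β' a x))
      (pair a x.1) := by
  have hx := pair_ne_zero ha x
  have hc := hasDerivAt_csch2 hx
  by_cases q : a ⬝ᵥ a = 1
  · have h1 := ((hc.const_mul (β ^ 2)).sub ((hasDerivAt_sech2 (pair a x.1)).const_mul
      (β' ^ 2))).const_mul (1 / 2)
    have e : potentialProfile β β' a = fun t => 1 / 2 * (β ^ 2 * csch2 t - β' ^ 2 * sech2 t) := by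
      funext t
      rw [potentialProfile, if_pos q]
    rw [e]
    refine h1.congr_deriv ?_
    have hs := Real.sinh_ne_zero.2 hx
    have hch := (Real.cosh_pos (pair a x.1)).ne'
    rw [rootCsch, rootCoth, if_pos q, if_pos q]
    -- Both sides equal 1/(sinh cosh), so the cross terms in ββ' cancel; this is why U contains only
    -- β² and β'².
    have h2 : csch2 (pair a x.1) * Real.tanh (pair a x.1) =
        sech2 (pair a x.1) * coth (pair a x.1) := by
      rw [csch2, sech2, coth, Real.tanh_eq_sinh_div_cosh]
      field_simp
    linear_combination (β * β') * h2
  · have e : potentialProfile β β' a = csch2 := by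
      funext t
      rw [potentialProfile, if_neg q]
    rw [e]
    refine hc.congr_deriv ?_
    rw [rootCsch, rootCoth, if_neg q, if_neg q]
    ring

theorem pair_update {N : ℕ} (a : Fin N → ℤ) (x : Fin N → ℝ) (i : Fin N) (t : ℝ) :
    pair a (Function.update x i t) = pair a x + a i * (t - x i) := by
  have h : Function.update x i t = x + Pi.single i (t - x i) := by
    funext k
    by_cases hk : k = i
    · subst hk
      simp
    · simp [hk]
  simp only [h, pair, Pi.add_apply, mul_add, Finset.sum_add_distrib]
  congr 1
  rw [Finset.sum_eq_single i] <;> simp +contextual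

theorem hasDerivAt_potential {N : ℕ} (β β' : ℝ) (x : RegularPoint N) (i : Fin N) :
    HasDerivAt (fun t => potential β β' (Function.update x.1 i t)) (potentialDeriv β β' i x)
      (x.1 i) := by
  simp only [potential_eq, potentialDeriv, ← Finset.sum_neg_distrib]
  refine HasDerivAt.fun_sum fun a ha => ?_
  have h1 : HasDerivAt (fun t => pair a (Function.update x.1 i t)) (a i : ℝ) (x.1 i) := by
    simp only [pair_update]
    simpa using (((hasDerivAt_id (x.1 i)).sub_const (x.1 i)).const_mul (a i : ℝ)).const_add
      (pair a x.1)
  have h2 := hasDerivAt_potentialProfile β β' ha x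
  have h3 : pair a x.1 = pair a (Function.update x.1 i (x.1 i)) := by
    rw [Function.update_eq_self]
  rw [h3] at h2
  refine (h2.comp (x.1 i) h1).congr_deriv ?_
  ring

/-- Reindexing the roots shows that a component of the gradient at v • x₀ is, up to sign, a
component of the gradient at x₀. -/
theorem potentialDeriv_smul_eq_zero {N : ℕ} {β β' : ℝ} {x₀ : RegularPoint N}
    (hx₀ : IsEquilibrium β β' x₀) (i : Fin N) (v : WeylGroup N) :
    potentialDeriv β β' i (v • x₀) = 0 := by
  have h0 : ∀ j, ∑ a ∈ roots N, (a j : ℝ) * (rootCsch β β' a x₀ * rootCoth β β' a x₀) = 0 :=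
    fun j => neg_eq_zero.1 ((hasDerivAt_potential β β' x₀ j).unique (hx₀ j))
  obtain ⟨w, rfl⟩ : ∃ w, v = w⁻¹ := ⟨v⁻¹, (inv_inv v).symm⟩
  rw [potentialDeriv, neg_eq_zero, ← sum_roots_act w⁻¹]
  simp only [rootCsch_inv_smul, rootCoth_inv_smul, ← act_mul, mul_inv_cancel, act_one]
  by_cases h : (w⁻¹).left i = 1
  · simp only [act, h, if_true]
    exact h0 _
  · simp only [act, h, if_false, Int.cast_neg, neg_mul, Finset.sum_neg_distrib, neg_eq_zero]
    exact h0 _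

theorem commutator_pow_succ {R : Type*} [Ring R] (a b : R) (m : ℕ) :
    a * b ^ (m + 1) - b ^ (m + 1) * a =
      (a * b ^ m - b ^ m * a) * b + b ^ m * (a * b - b * a) := by
  rw [pow_succ]
  noncomm_ring

/-! ### Operators vanishing on an orbit -/

/-- The coefficients of an operator vanish on the orbit of a point. -/
def VanishesOnOrbit {N : ℕ} (x₀ : RegularPoint N) (A : OpAlgebra N) : Prop :=
  ∀ w v : WeylGroup N, A.coeff w (v • x₀) = 0

namespace VanishesOnOrbit

variable {N : ℕ} {x₀ : RegularPoint N} {A : OpAlgebra N}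

theorem zero : VanishesOnOrbit x₀ (0 : OpAlgebra N) := fun _ _ => rfl

theorem add {B : OpAlgebra N} (hA : VanishesOnOrbit x₀ A) (hB : VanishesOnOrbit x₀ B) :
    VanishesOnOrbit x₀ (A + B) := fun w v => by
  have h : (A + B).coeff w (v • x₀) = A.coeff w (v • x₀) + B.coeff w (v • x₀) := by
    rw [SkewMonoidAlgebra.coeff_add]
    rfl
  rw [h, hA, hB, add_zero]

theorem sum {ι : Type*} (s : Finset ι) {f : ι → OpAlgebra N}
    (hf : ∀ i ∈ s, VanishesOnOrbit x₀ (f i)) : VanishesOnOrbit x₀ (∑ i ∈ s, f i) :=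
  Finset.sum_induction f (VanishesOnOrbit x₀) (fun _ _ => add) zero hf

/-- Multiplying by f u on the left evaluates the coefficients of A at points moved by u⁻¹. Vanishing
at x₀ alone would not survive this, whereas vanishing on the orbit does. -/
theorem mul_left (hA : VanishesOnOrbit x₀ A) (B : OpAlgebra N) : VanishesOnOrbit x₀ (B * A) := by
  induction B using SkewMonoidAlgebra.induction_on with
  | zero => rw [zero_mul]; exact zero
  | single u f =>
    intro w v
    rw [SkewMonoidAlgebra.coeff_single_mul, Pi.mul_apply, weyl_smul_apply, ← mul_smul, hA, mul_zero]
  | add f g hf hg => rw [add_mul]; exact hf.add hg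

theorem mul_right (hA : VanishesOnOrbit x₀ A) (B : OpAlgebra N) : VanishesOnOrbit x₀ (A * B) := by
  induction B using SkewMonoidAlgebra.induction_on with
  | zero => rw [mul_zero]; exact zero
  | single u f =>
    intro w v
    rw [SkewMonoidAlgebra.coeff_mul_single, Pi.mul_apply, hA, zero_mul]
  | add f g hf hg => rw [mul_add]; exact hf.add hg

theorem commutator_pow {H : OpAlgebra N} (h : VanishesOnOrbit x₀ (H * A - A * H)) (m : ℕ) :
    VanishesOnOrbit x₀ (H * A ^ m - A ^ m * H) := by
  induction m with
  | zero => rw [pow_zero, mul_one, one_mul, sub_self]; exact zero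
  | succ m ih =>
    rw [commutator_pow_succ]
    exact (ih.mul_right A).add (h.mul_left _)

theorem star_eq_zero (hA : VanishesOnOrbit x₀ A) (n : ℕ) : star n A x₀ = 0 :=
  Finset.sum_eq_zero fun w _ => by
    have h := hA w 1
    rw [one_smul] at h
    simp only [h, mul_zero, zero_smul]

end VanishesOnOrbit

theorem commutator_hamiltonian_calI {N : ℕ} {β β' : ℝ} {x₀ : RegularPoint N}
    (hx₀ : IsEquilibrium β β' x₀) (p : ℕ) :
    VanishesOnOrbit x₀ (hamiltonian N β β' * calI β β' p - calI β β' p * hamiltonian N β β') := by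
  rw [calI, Finset.mul_sum, Finset.sum_mul, ← Finset.sum_sub_distrib]
  refine VanishesOnOrbit.sum _ fun i _ => VanishesOnOrbit.commutator_pow ?_ _
  intro w v
  classical
  rw [hamiltonian_mul_calJ_sub, SkewMonoidAlgebra.coeff_single_apply]
  split_ifs
  · exact potentialDeriv_smul_eq_zero hx₀ i v
  · rfl

/-! ### The star mapping -/

theorem star_zero {N : ℕ} (n : ℕ) : star n (0 : OpAlgebra N) = 0 := rfl

theorem star_sum {N : ℕ} (n : ℕ) {ι : Type*} (s : Finset ι) (f : ι → OpAlgebra N)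
    (x : RegularPoint N) : star n (∑ i ∈ s, f i) x = ∑ i ∈ s, star n (f i) x := by
  have h := map_sum (⟨⟨star n, star_zero n⟩, star_add n⟩ :
    OpAlgebra N →+ (RegularPoint N → Module.End ℂ (SpinSpace N n))) f s
  exact (congrFun h x).trans (Finset.sum_apply _ _ _)

/-- For B = g v the operator f B w equals f g (v w), whose star image has spin part S(w⁻¹) S(v⁻¹),
already in the order of the product of the two star images. The commutation hypothesis serves only
to rewrite f w B as f B w. -/
theorem star_single_mul {N : ℕ} (n : ℕ) (w : WeylGroup N) (f : CoeffFun N) {B : OpAlgebra N}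
    (hB : Commute (SkewMonoidAlgebra.single w 1) B) (x : RegularPoint N) :
    star n (SkewMonoidAlgebra.single w f * B) x =
      star n (SkewMonoidAlgebra.single w f) x * star n B x := by
  have h1 : SkewMonoidAlgebra.single w f * B =
      SkewMonoidAlgebra.single 1 f * B * SkewMonoidAlgebra.single w 1 := by
    rw [mul_assoc, ← hB.eq, ← mul_assoc, SkewMonoidAlgebra.single_mul_single, one_mul, smul_one,
      mul_one]
  rw [h1, star_single]
  -- The remaining identity is linear in B and holds without commutation, so it may be checked on
  -- single terms.
  clear h1 hB
  induction B using SkewMonoidAlgebra.induction_on with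
  | zero => rw [mul_zero, zero_mul, star_zero, Pi.zero_apply, mul_zero]
  | single v g =>
    rw [SkewMonoidAlgebra.single_mul_single, SkewMonoidAlgebra.single_mul_single, star_single,
      star_single, one_mul, one_smul, smul_one, mul_one, smul_mul_smul_comm, ← map_mul,
      ← mul_inv_rev, map_mul, Pi.mul_apply]
    congr 1
    push_cast
    ring
  | add B C hB hC =>
    rw [mul_add, add_mul, star_add, star_add, Pi.add_apply, Pi.add_apply, hB, hC, mul_add]

theorem star_mul_of_commute {N : ℕ} (n : ℕ) (A : OpAlgebra N) {B : OpAlgebra N}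
    (hB : ∀ w, Commute (SkewMonoidAlgebra.single w 1) B) (x : RegularPoint N) :
    star n (A * B) x = star n A x * star n B x := by
  induction A using SkewMonoidAlgebra.induction_on with
  | zero => rw [zero_mul, star_zero, Pi.zero_apply, zero_mul]
  | single w f => exact star_single_mul n w f (hB w) x
  | add f g hf hg => rw [add_mul, star_add, star_add, Pi.add_apply, Pi.add_apply, hf, hg, add_mul]

theorem star_reflectionSum_mul {N : ℕ} (n : ℕ) (f : (Fin N → ℤ) → CoeffFun N) {B : OpAlgebra N}
    (hB : ∀ a ∈ roots N, Commute (SkewMonoidAlgebra.single (reflection a) 1) B)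
    (x : RegularPoint N) :
    star n (reflectionSum f * B) x = star n (reflectionSum f) x * star n B x := by
  rw [reflectionSum, Finset.sum_mul, star_sum, star_sum, Finset.sum_mul]
  exact Finset.sum_congr rfl fun a ha => star_single_mul n _ _ (hB a ha) x

/-- The sign is the parity of a reflection. The roots ±α share a reflection, which the half in
`hamiltonianCoeff` offsets for short roots; for long roots the sum over ordered pairs already counts
twice, hence the factor 2 in `rootCsch`. -/
theorem calHStar_eq {N : ℕ} (n : ℕ) (β β' : ℝ) (x : RegularPoint N) :
    calHStar n β β' x = (-1 : ℝ) • star n (hamiltonian N β β') x := by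
  have h1 : (-1 : ℝ) • star n (hamiltonian N β β') x =
      ∑ a ∈ roots N, (1 / 2 * rootCsch β β' a x) • spinRep n (reflection a) := by
    rw [hamiltonian, reflectionSum, star_sum, Finset.smul_sum]
    refine Finset.sum_congr rfl fun a ha => ?_
    rw [star_single, parity_reflection ha, reflection_inv ha, hamiltonianCoeff, smul_smul]
    congr 1
    push_cast
    ring
  rw [h1, sum_roots (fun a => (1 / 2 * rootCsch β β' a x) • spinRep n (reflection a))
    (fun a => by rw [rootCsch_neg, reflection_neg]), calHStar, add_comm]
  congr 1
  · refine Finset.sum_congr rfl fun i _ => ?_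
    rw [← add_smul, rootCsch, if_pos (by simp), pair_single, Int.cast_one, one_mul,
      reflection_flip, spinFlip]
    congr 1
    ring
  · refine Finset.sum_congr rfl fun i _ => Finset.sum_congr rfl fun j hj => ?_
    have hij : i ≠ j := (Finset.mem_filter.1 hj).2.symm
    have h : (Pi.single i 1 + Pi.single j 1 : Fin N → ℤ) ⬝ᵥ (Pi.single i 1 + Pi.single j 1) = 2 :=
      single_add_single_sq hij 1 1
    simp only [rootCsch, pair_add, pair_sub, pair_single]
    rw [single_sub_single_sq hij, h, if_neg (by norm_num), if_neg (by norm_num), Int.cast_one,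
      one_mul, one_mul, reflection_exch hij, reflection_exchTilde hij, spinExch, spinExchTilde,
      spinFlip, spinFlip, spinExch, exchTilde, map_mul, map_mul, ← mul_assoc, ← mul_assoc]
    norm_num

end SutherlandBN

end

/-! ### The commutation theorem. -/

theorem mainTheorem4 (N n : ℕ) (β β' : ℝ) (x₀ : SutherlandBN.RegularPoint N)
    (hx₀ : SutherlandBN.IsEquilibrium β β' x₀) (p : ℕ) :
    Commute (SutherlandBN.calIStar n β β' p x₀) (SutherlandBN.calHStar n β β' x₀) := by
  rw [SutherlandBN.calHStar_eq, SutherlandBN.calIStar]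
  refine Commute.smul_right ?_ _
  have h1 := SutherlandBN.star_mul_of_commute n (SutherlandBN.calI β β' p)
    (SutherlandBN.commute_hamiltonian β β') x₀
  have h2 : SutherlandBN.star n (SutherlandBN.hamiltonian N β β' * SutherlandBN.calI β β' p) x₀ = _ :=
    SutherlandBN.star_reflectionSum_mul n _
      (fun a ha => SutherlandBN.commute_reflection_calI β β' p ha) x₀
  have h3 := (SutherlandBN.commutator_hamiltonian_calI hx₀ p).star_eq_zero n
  -- Additivity of `star` on H ℐ_p = [H, ℐ_p] + ℐ_p H; the bracket drops out at x₀.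
  have h4 := congrFun (SutherlandBN.star_add n
    (SutherlandBN.hamiltonian N β β' * SutherlandBN.calI β β' p -
      SutherlandBN.calI β β' p * SutherlandBN.hamiltonian N β β')
    (SutherlandBN.calI β β' p * SutherlandBN.hamiltonian N β β')) x₀
  rw [sub_add_cancel, Pi.add_apply, h3, zero_add] at h4
  rw [Commute, SemiconjBy, ← h1, ← h4, h2]
  rfl
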